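/- **Setting.** Let $\mathcal H$ be a separable Hilbert space over $\mathbb K\in\{\mathbb R,\mathbb C\}$, let $a(\cdot,\cdot)$ be a hermitian, continuous sesquilinear form with $a(v,v)\ge\alpha\|v\|_{\mathcal H}^2$ for some $\alpha>0$ and all $v\in\mathcal H$, let $\mathcal K:\mathcal H\to\mathcal H^*$ be compact and linear, and let $f\in\mathcal H^*$. Put $b(w,v)=a(w,v)+\langle\mathcal Kw,v\rangle$, suppose that $w=0$ is the only $w\in\mathcal H$ with $b(w,\cdot)=0$, and let $u\in\mathcal H$ solve $b(u,v)=\langle f,v\rangle$ for all $v\in\mathcal H$. For a finite-dimensional subspace $\mathcal X\subseteq\mathcal H$, let $\gamma(\mathcal X)=\inf_{W\in\mathcal X\setminus\{0\}}\sup_{V\in\mathcal X\setminus\{0\}}|b(W,V)|/(\|W\|_{\mathcal H}\|V\|_{\mathcal H})$. Let $\mathcal T_0$ be an initial triangulation of $\Omega\subset\mathbb R^d$, without any assumption on its fineness. Let $\mathrm{refine}(\mathcal T,\mathcal M)$ be a mesh-refinement strategy which returns, for a conforming $\mathcal T$ and $\mathcal M\subseteq\mathcal T$, a conforming refinement of $\mathcal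 T$ with the minimal number of elements in which all elements of $\mathcal M$ are refined. Write $\mathcal T_+\in\mathrm{refine}(\mathcal T)$ if $\mathcal T_+$ is obtained from $\mathcal T$ by finitely many such steps, and $\mathbb T=\mathrm{refine}(\mathcal T_0)$. Refinement contracts the local mesh-size on refined elements by a uniform factor $q_{\rm mesh}<1$. Each $\mathcal T_\star\in\mathbb T$ has a finite-dimensional space $\mathcal X_\star\subseteq\mathcal H$; these spaces are nested under refinement, and $\overline{\bigcup_\ell\mathcal X_\ell}=\mathcal H$ for each sequence of successive refinements of $\mathcal T_0$ with infinitely many uniform steps $\mathcal T_{\ell+1}=\mathrm{refine}(\mathcal T_\ell,\mathcal T_\ell)$. We say that $U_\star$ exists if there is a unique $U_\star\in\mathcal X_\star$ with $b(U_\star,V)=\langle f,V\rangle$ for all $V\in\mathcal X_\star$. Let $\eta_\star(T)\ge0$, $T\in\mathcal T_\star$, be local indicators, $\eta_\star(\mathcal U)=(\sum_{T\in\mathcal U}\eta_\star(T)^2)^{1/2}$ and $\eta_\star=\eta_\star(\mathcal T_\star)$. **Axioms.** There are $C_{\rm stb},C_{\rm red},C_{\rm rel}',C_{\rm rel}>0$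 and $0<q_{\rm red}<1$ such that for all $\mathcal T_\star\in\mathbb T$ and $\mathcal T_+\in\mathrm{refine}(\mathcal T_\star)$ for which $U_\star$ and $U_+$ exist (in (A3): $U_\star$ exists), (A1) $|\eta_+(\mathcal T_+\cap\mathcal T_\star)-\eta_\star(\mathcal T_+\cap\mathcal T_\star)|\le C_{\rm stb}\|U_+-U_\star\|_{\mathcal H}$; (A2) $\eta_+(\mathcal T_+\setminus\mathcal T_\star)^2\le q_{\rm red}\,\eta_\star(\mathcal T_\star\setminus\mathcal T_+)^2+C_{\rm red}^2\|U_+-U_\star\|_{\mathcal H}^2$; (A3) $\|u-U_\star\|_{\mathcal H}\le C_{\rm rel}'\eta_\star$; (A4) there is $\mathcal R$ with $\mathcal T_\star\setminus\mathcal T_+\subseteq\mathcal R\subseteq\mathcal T_\star$, $\#\mathcal R\le C_{\rm rel}\#(\mathcal T_\star\setminus\mathcal T_+)$ and $\|U_+-U_\star\|_{\mathcal H}\le C_{\rm rel}\,\gamma(\mathcal X_+)^{-1}\eta_\star(\mathcal R)$. **Mesh properties.** One refinement step splits each refined element into at least $2$ and at most $C_{\rm son}$ elements, and for all $\mathcal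 T\in\mathbb T$ and $\mathcal T_1,\mathcal T_2\in\mathrm{refine}(\mathcal T)$ there is $\mathcal T'\in\mathrm{refine}(\mathcal T_1)\cap\mathrm{refine}(\mathcal T_2)$ with $\#\mathcal T'\le\#\mathcal T_1+\#\mathcal T_2-\#\mathcal T$. **Algorithm.** Let $\theta>0$, $C_{\rm mark}\ge1$, $U_{-1}=0$, $\eta_{-1}=1$. For $\ell=0,1,2,\dots$: if $U_\star$ does not exist for $\mathcal T_\star=\mathcal T_\ell$, let $U_\ell=U_{\ell-1}$, $\eta_\ell=\eta_{\ell-1}$ and $\mathcal M_\ell=\mathcal T_\ell$; otherwise, let $U_\ell$ and $\eta_\ell$ be the discrete solution and the estimator on $\mathcal T_\ell$ and let $\mathcal M_\ell\subseteq\mathcal T_\ell$ be a set, of minimal cardinality up to the factor $C_{\rm mark}$, with $\theta\eta_\ell^2\le\eta_\ell(\mathcal M_\ell)^2$. In both cases, $\mathcal T_{\ell+1}=\mathrm{refine}(\mathcal T_\ell,\mathcal M_\ell)$. We consider runs for which (A5) $\mathcal X_\infty:=\overline{\bigcup_\ell\mathcal X_\ell}$ contains no $w\ne0$ with $b(w,v)=0$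 for all $v\in\mathcal X_\infty$, and for which $\mathcal X_\infty=\mathcal H$ and $\#\mathcal T_\ell-\#\mathcal T_0\le C_{\rm mesh}\sum_{j<\ell}\#\mathcal M_j$ for all $\ell$, with a constant $C_{\rm mesh}\ge1$. **Approximation class.** For $s>0$, let $\|u\|_{\mathbb A_s}=\sup_{N\in\mathbb N_0}(N+1)^s\min_{\mathcal T_\star\in\mathbb T_N}\eta_\star\in[0,\infty]$, where $\mathbb T_N$ is the set of all $\mathcal T_\star\in\mathbb T$ with $\#\mathcal T_\star-\#\mathcal T_0\le N$ for which $U_\star$ exists, and $\min\emptyset:=0$. **Theorem.** For $m\in\mathbb N_0$, let $\widehat{\mathcal T}_0$, with space $\widehat{\mathcal X}_0$, be the $m$-times uniform refinement of $\mathcal T_0$, and for $\widehat\gamma_0>0$ let $\theta_{\rm opt}=(1+C_{\rm stb}^2C_{\rm rel}^2/\widehat\gamma_0^2)^{-1}$. (i) There are $m$ and $\widehat\gamma_0>0$ such that $\gamma(\mathcal X)\ge\widehat\gamma_0$ for all finite-dimensional $\mathcal X$ with $\widehat{\mathcal X}_0\subseteq\mathcal X\subseteq\mathcal H$. (ii)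 Let $m$ and $\widehat\gamma_0>0$ be such that $\gamma(\mathcal X_\star)\ge\widehat\gamma_0$ for all $\mathcal T_\star\in\mathrm{refine}(\widehat{\mathcal T}_0)$, and let $0<\theta<\theta_{\rm opt}$. Then there is $0<\varepsilon<1$ such that each run has an index $\ell_3$ with $$a(u-U_{\ell+1},u-U_{\ell+1})+a(U_{\ell+1}-U_\ell,U_{\ell+1}-U_\ell)\le\tfrac1{1-\varepsilon}\,a(u-U_\ell,u-U_\ell)\quad\text{for all }\ell\ge\ell_3,$$ and such that the following holds for all $s>0$ and $n\in\mathbb N_0$: There is $C_{\rm opt}>0$, which does not depend on the run, such that for all $C\ge C_{\rm opt}$, for each run, for each such $\ell_3$ and for each $\ell_5$ with $\mathcal T_\ell\in\mathrm{refine}(\widehat{\mathcal T}_0)$ for all $\ell\ge\ell_5$, it holds with $\ell_6=\max\{\ell_3,\ell_5\}$, provided that $\#\mathcal T_{\ell_6}=n$, $$\|u\|_{\mathbb A_s}<\infty\iff\forall\ell\ge\ell_6:\ \eta_\ell\le C\,(\#\mathcal T_\ell-\#\mathcal T_0+1)^{-s}.$$ (iii) Let $m$ and $\widehat\gamma_0$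 be as in (i), and let $0<\theta<\theta_{\rm opt}$. Then each run has an index $\ell_6$ such that for all $s>0$ there is $C_{\rm opt}>0$ such that the equivalence in (ii) holds for all $C\ge C_{\rm opt}$. -/

import Mathlib

open MeasureTheory

noncomputable section

namespace AFEM

/-! ### Triangulations and mesh refinement -/

/-- A triangulation of `Ω ⊆ ℝᵈ`: finitely many compact elements of positive volume which cover the
closure of `Ω` and overlap only in null sets. The shape of the elements and the notion of conformity
are left to the refinement strategy. -/
@[ext]
structure Triangulation {d : ℕ} (Ω : Set (EuclideanSpace ℝ (Fin d))) where
  elems : Finset (Set (EuclideanSpace ℝ (Fin d)))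
  isCompact : ∀ E ∈ elems, IsCompact E
  volume_pos : ∀ E ∈ elems, 0 < volume E
  cover : ⋃ E ∈ elems, E = closure Ω
  overlap : ∀ E ∈ elems, ∀ E' ∈ elems, E ≠ E' → volume (E ∩ E') = 0

variable {d : ℕ} {Ω : Set (EuclideanSpace ℝ (Fin d))}

/-- The number of elements `#𝒯`. -/
def Triangulation.card (T : Triangulation Ω) : ℕ := T.elems.card

open Classical in
/-- `𝒯 ∖ 𝒯'`, the elements of `𝒯` which are not in `𝒯'`. -/
def Triangulation.sdiff (T T' : Triangulation Ω) : Finset (Set (EuclideanSpace ℝ (Fin d))) :=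
  T.elems \ T'.elems

open Classical in
/-- `𝒯 ∩ 𝒯'`, the common elements. -/
def Triangulation.inter (T T' : Triangulation Ω) : Finset (Set (EuclideanSpace ℝ (Fin d))) :=
  T.elems ∩ T'.elems

open Classical in
/-- The sons in `𝒯` of an element `E` of a coarser triangulation. -/
def Triangulation.sons (T : Triangulation Ω) (E : Set (EuclideanSpace ℝ (Fin d))) :
    Finset (Set (EuclideanSpace ℝ (Fin d))) :=
  T.elems.filter (fun E' => E' ⊆ E)

/-- Every element of `T` is the union of the elements of `T'` which it contains. -/
def Triangulation.Subdivides (T' T : Triangulation Ω) : Prop :=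
  ∀ E ∈ T.elems, E = ⋃ E' ∈ T'.sons E, E'

/-- The local mesh-size `|E|^{1/d}`. -/
def meshSize (E : Set (EuclideanSpace ℝ (Fin d))) : ℝ :=
  (volume E).toReal ^ (1 / (d : ℝ))

/-- A mesh-refinement strategy: for a conforming triangulation `T` and marked elements `M ⊆ T`,
`refine T M` is a conforming refinement of `T` in which all elements of `M` are refined, and it has
the minimal number of elements among all of these. `Conforming` is the class of
triangulations with which the strategy works. -/
structure RefinementStrategy (Ω : Set (EuclideanSpace ℝ (Fin d))) where
  Conforming : Triangulation Ω → Prop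
  refine : Triangulation Ω → Finset (Set (EuclideanSpace ℝ (Fin d))) → Triangulation Ω
  conforming_refine : ∀ T M, Conforming T → M ⊆ T.elems → Conforming (refine T M)
  subdivides_refine : ∀ T M, Conforming T → M ⊆ T.elems → (refine T M).Subdivides T
  marked_refined : ∀ T M, Conforming T → M ⊆ T.elems → M ⊆ T.sdiff (refine T M)
  card_minimal : ∀ T M, Conforming T → M ⊆ T.elems → ∀ T', Conforming T' → T'.Subdivides T →
    M ⊆ T.sdiff T' → (refine T M).card ≤ T'.card

/-- `S.Refines T T'` means `T' ∈ refine(T)`: `T'` is obtained from `T` by finitely many steps. -/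
def RefinementStrategy.Refines (S : RefinementStrategy Ω) : Triangulation Ω → Triangulation Ω → Prop :=
  Relation.ReflTransGen (fun T T' => ∃ M, M ⊆ T.elems ∧ T' = S.refine T M)

/-- One step of uniform refinement. -/
def RefinementStrategy.uniformStep (S : RefinementStrategy Ω) (T : Triangulation Ω) :
    Triangulation Ω :=
  S.refine T T.elems

/-! ### The continuous problem -/

variable {𝕜 : Type*} [RCLike 𝕜] {H : Type*} [NormedAddCommGroup H] [InnerProductSpace 𝕜 H]

/-- A well-posed, compactly perturbed elliptic problem
`b(u, v) := a(u, v) + ⟨K u, v⟩ = ⟨f, v⟩` for all `v`. Sesquilinear forms are linear in the first and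
conjugate-linear in the second argument, so the dual space consists of the continuous
conjugate-linear functionals. -/
structure Problem (𝕜 : Type*) [RCLike 𝕜] (H : Type*) [NormedAddCommGroup H]
    [InnerProductSpace 𝕜 H] where
  a : H →L[𝕜] H →L⋆[𝕜] 𝕜
  K : H →L[𝕜] H →L⋆[𝕜] 𝕜
  f : H →L⋆[𝕜] 𝕜
  u : H
  hermitian : ∀ v w, a v w = starRingEnd 𝕜 (a w v)
  elliptic : ∃ α : ℝ, 0 < α ∧ ∀ v, α * ‖v‖ ^ 2 ≤ RCLike.re (a v v)
  compact : IsCompactOperator K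
  wellPosed : ∀ w, w = 0 ↔ ∀ v, (a + K) w v = 0
  solves : ∀ v, (a + K) u v = f v

namespace Problem

variable (P : Problem 𝕜 H)

/-- `b(w, v) = a(w, v) + ⟨K w, v⟩`. -/
def b : H →L[𝕜] H →L⋆[𝕜] 𝕜 := P.a + P.K

/-- The squared energy norm `a(v, v)`. -/
def energySq (v : H) : ℝ := RCLike.re (P.a v v)

/-- `U ∈ V` solves the Galerkin formulation in the subspace `V`. -/
def IsGalerkinSolution (V : Submodule 𝕜 H) (U : H) : Prop :=
  U ∈ V ∧ ∀ v ∈ V, P.b U v = P.f v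

/-- The Galerkin formulation in `V` has a unique solution. -/
def Solvable (V : Submodule 𝕜 H) : Prop := ∃! U, P.IsGalerkinSolution V U

open Classical in
/-- The Galerkin solution in `V`; the value `0` for `V` without unique solution is never used. -/
def galerkin (V : Submodule 𝕜 H) : H :=
  if h : P.Solvable V then h.choose else 0

/-- The inf-sup constant
`inf_{W ∈ V∖{0}} sup_{v ∈ V∖{0}} |b(W, v)| / (‖W‖ ‖v‖)` (which is `∞` for `V = {0}`). -/
def infSup (V : Submodule 𝕜 H) : ENNReal :=
  ⨅ W ∈ {W : H | W ∈ V ∧ W ≠ 0}, ⨆ v ∈ {v : H | v ∈ V ∧ v ≠ 0},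
    ENNReal.ofReal (‖P.b W v‖ / (‖W‖ * ‖v‖))

end Problem

/-! ### The discretization and the error estimator -/

/-- An initial mesh `T0` with a refinement strategy, discrete spaces `X T` for all refinements `T`
of `T0`, and local refinement indicators `η T E` for the elements `E` of `T`. (The indicators may
depend on the Galerkin solution in `X T`, which is determined by `T`.) -/
structure Discretization (𝕜 : Type*) [RCLike 𝕜] (H : Type*) [NormedAddCommGroup H]
    [InnerProductSpace 𝕜 H] (Ω : Set (EuclideanSpace ℝ (Fin d))) where
  S : RefinementStrategy Ω
  T0 : Triangulation Ω
  conforming_T0 : S.Conforming T0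
  contraction : ∃ q : ℝ, 0 < q ∧ q < 1 ∧ ∀ T T', S.Refines T0 T → S.Refines T T' →
    ∀ E ∈ T.sdiff T', ∀ E' ∈ T'.sons E, meshSize E' ≤ q * meshSize E
  X : Triangulation Ω → Submodule 𝕜 H
  finiteDimensional : ∀ T, S.Refines T0 T → FiniteDimensional 𝕜 (X T)
  nested : ∀ T T', S.Refines T0 T → S.Refines T T' → X T ≤ X T'
  /-- Infinitely many steps of uniform refinement lead to a dense subspace. -/
  dense : ∀ (T : ℕ → Triangulation Ω) (M : ℕ → Finset (Set (EuclideanSpace ℝ (Fin d)))),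
    T 0 = T0 → (∀ l, M l ⊆ (T l).elems) → (∀ l, T (l + 1) = S.refine (T l) (M l)) →
    {l | M l = (T l).elems}.Infinite → closure (⋃ l, (X (T l) : Set H)) = Set.univ
  η : Triangulation Ω → Set (EuclideanSpace ℝ (Fin d)) → ℝ
  η_nonneg : ∀ T, S.Refines T0 T → ∀ E ∈ T.elems, 0 ≤ η T E

namespace Discretization

variable (P : Problem 𝕜 H) (D : Discretization 𝕜 H Ω)

/-- `T ∈ 𝕋 = refine(T0)`. -/
def Admissible (T : Triangulation Ω) : Prop := D.S.Refines D.T0 T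

/-- The discrete solution `U_T ∈ X T` exists (uniquely). -/
def Solvable (T : Triangulation Ω) : Prop := P.Solvable (D.X T)

/-- The discrete solution `U_T`. -/
def sol (T : Triangulation Ω) : H := P.galerkin (D.X T)

/-- `η_T(𝒰) = (∑_{E ∈ 𝒰} η_T(E)²)^{1/2}`. -/
def etaOn (T : Triangulation Ω) (A : Finset (Set (EuclideanSpace ℝ (Fin d)))) : ℝ :=
  Real.sqrt (∑ E ∈ A, D.η T E ^ 2)

/-- The error estimator `η_T = η_T(T)`. -/
def eta (T : Triangulation Ω) : ℝ := D.etaOn T T.elems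

/-- (A1) stability on non-refined element domains. -/
def Stability (Cstb : ℝ) : Prop :=
  ∀ T T', D.Admissible T → D.S.Refines T T' → D.Solvable P T → D.Solvable P T' →
    |D.etaOn T' (T'.inter T) - D.etaOn T (T'.inter T)| ≤ Cstb * ‖D.sol P T' - D.sol P T‖

/-- (A2) reduction on refined element domains. -/
def Reduction (Cred qred : ℝ) : Prop :=
  ∀ T T', D.Admissible T → D.S.Refines T T' → D.Solvable P T → D.Solvable P T' →
    D.etaOn T' (T'.sdiff T) ^ 2 ≤
      qred * D.etaOn T (T.sdiff T') ^ 2 + Cred ^ 2 * ‖D.sol P T' - D.sol P T‖ ^ 2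

/-- (A3) reliability. -/
def Reliability (Crel' : ℝ) : Prop :=
  ∀ T, D.Admissible T → D.Solvable P T → ‖P.u - D.sol P T‖ ≤ Crel' * D.eta T

/-- (A4) discrete reliability, with the inf-sup constant of the finer space. -/
def DiscreteReliability (Crel : ℝ) : Prop :=
  ∀ T T', D.Admissible T → D.S.Refines T T' → ∃ R, R ⊆ T.elems ∧
    (D.Solvable P T → D.Solvable P T' →
      ‖D.sol P T' - D.sol P T‖ ≤ Crel * (P.infSup (D.X T')).toReal⁻¹ * D.etaOn T R ∧
      T.sdiff T' ⊆ R ∧ (R.card : ℝ) ≤ Crel * ((T.sdiff T').card : ℝ))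

/-- Each refined element is split into at least `2` and at most `Cson` sons. -/
def SonBounds (Cson : ℕ) : Prop :=
  ∀ T M, D.Admissible T → M ⊆ T.elems → ∀ E ∈ T.sdiff (D.S.refine T M),
    2 ≤ ((D.S.refine T M).sons E).card ∧ ((D.S.refine T M).sons E).card ≤ Cson

/-- Overlay estimate: `#(T₁ ⊕ T₂) ≤ #T₁ + #T₂ - #T` for a common refinement `T₁ ⊕ T₂`. -/
def Overlay : Prop :=
  ∀ T T₁ T₂, D.Admissible T → D.S.Refines T T₁ → D.S.Refines T T₂ →
    ∃ T', D.S.Refines T₁ T' ∧ D.S.Refines T₂ T' ∧ T'.card + T.card ≤ T₁.card + T₂.card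

/-- The `m`-times uniform refinement of the initial mesh. -/
def uniform (m : ℕ) : Triangulation Ω := D.S.uniformStep^[m] D.T0

/-- `𝕋_N(T)`: all `T' ∈ refine(T)` with `#T' - #T ≤ N` for which the discrete solution exists. -/
def meshesUpTo (T : Triangulation Ω) (N : ℕ) : Set (Triangulation Ω) :=
  {T' | D.S.Refines T T' ∧ T'.card ≤ T.card + N ∧ D.Solvable P T'}

/-- `‖u‖_{𝔸_s} = sup_N (N + 1)^s min_{T ∈ 𝕋_N(T0)} η_T ∈ [0, ∞]`. The minimum over the empty set is
`0` by convention, which is the value of `sInf` there. -/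
def approxNorm (s : ℝ) : ENNReal :=
  ⨆ N : ℕ, ENNReal.ofReal (((N : ℝ) + 1) ^ s * sInf (D.eta '' D.meshesUpTo P D.T0 N))

end Discretization

/-! ### The adaptive algorithm -/

/-- Meshes and marked elements generated by the adaptive algorithm with marking parameters `θ` and
`Cmark`: uniform refinement if there is no unique discrete solution; otherwise, refinement of a set
which satisfies the Dörfler criterion and which has, up to the factor `Cmark`, minimal cardinality. -/
structure AdaptiveRun (P : Problem 𝕜 H) (D : Discretization 𝕜 H Ω) (θ Cmark : ℝ) where
  mesh : ℕ → Triangulation Ω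
  marked : ℕ → Finset (Set (EuclideanSpace ℝ (Fin d)))
  mesh_zero : mesh 0 = D.T0
  mesh_succ : ∀ l, mesh (l + 1) = D.S.refine (mesh l) (marked l)
  marked_subset : ∀ l, marked l ⊆ (mesh l).elems
  marked_uniform : ∀ l, ¬ D.Solvable P (mesh l) → marked l = (mesh l).elems
  doerfler : ∀ l, D.Solvable P (mesh l) →
    θ * D.eta (mesh l) ^ 2 ≤ D.etaOn (mesh l) (marked l) ^ 2
  marked_minimal : ∀ l, D.Solvable P (mesh l) → ∀ M, M ⊆ (mesh l).elems →
    θ * D.eta (mesh l) ^ 2 ≤ D.etaOn (mesh l) M ^ 2 → ((marked l).card : ℝ) ≤ Cmark * (M.card : ℝ)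

namespace AdaptiveRun

variable {P : Problem 𝕜 H} {D : Discretization 𝕜 H Ω} {θ Cmark : ℝ} (r : AdaptiveRun P D θ Cmark)

open Classical in
/-- The discrete solutions `U_ℓ` of the algorithm, with `U_{-1} = 0` and `U_ℓ = U_{ℓ-1}` if there is
no unique discrete solution. -/
def U : ℕ → H
  | 0 => if D.Solvable P (r.mesh 0) then D.sol P (r.mesh 0) else 0
  | l + 1 => if D.Solvable P (r.mesh (l + 1)) then D.sol P (r.mesh (l + 1)) else U l

open Classical in
/-- The estimators `η_ℓ` of the algorithm, with `η_{-1} = 1` and `η_ℓ = η_{ℓ-1}` if there is no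
unique discrete solution. -/
def est : ℕ → ℝ
  | 0 => if D.Solvable P (r.mesh 0) then D.eta (r.mesh 0) else 1
  | l + 1 => if D.Solvable P (r.mesh (l + 1)) then D.eta (r.mesh (l + 1)) else est l

/-- The discrete limit space `X_∞`, the closure of the union of all `X_ℓ`. -/
def limitSpace : Set H := closure (⋃ l, (D.X (r.mesh l) : Set H))

/-- (A5) definiteness of `b` on `X_∞`. -/
def LimitDefinite : Prop :=
  ∀ w ∈ r.limitSpace, (∀ v ∈ r.limitSpace, P.b w v = 0) → w = 0

/-- The mesh-closure estimate. -/
def MeshClosure (Cmesh : ℝ) : Prop :=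
  ∀ l, ((r.mesh l).card : ℝ) - (D.T0.card : ℝ) ≤
    Cmesh * ∑ j ∈ Finset.range l, ((r.marked j).card : ℝ)

/-- The quasi-orthogonality with parameter `ε` in the energy norm holds from the index `l₃` on. -/
def QuasiOrthogonalFrom (ε : ℝ) (l₃ : ℕ) : Prop :=
  ∀ l ≥ l₃, P.energySq (P.u - r.U (l + 1)) + P.energySq (r.U (l + 1) - r.U l) ≤
    1 / (1 - ε) * P.energySq (P.u - r.U l)

/-- `η_ℓ ≤ C (#T_ℓ - #T_0 + 1)^{-s}` for all `ℓ ≥ l₆`. -/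
def RateFrom (s C : ℝ) (l₆ : ℕ) : Prop :=
  ∀ l ≥ l₆, r.est l ≤ C * (((r.mesh l).card : ℝ) - (D.T0.card : ℝ) + 1) ^ (-s)

end AdaptiveRun

/-- `θ_opt = (1 + C_stb² C_rel² / γ²)⁻¹`. -/
def thetaOpt (Cstb Crel γ : ℝ) : ℝ := (1 + Cstb ^ 2 * Crel ^ 2 / γ ^ 2)⁻¹

end AFEM

end

/-! Compactness drives the stability half. If unit vectors `w n` are asymptotically `b`-orthogonal
to a dense increasing sequence of spaces, their weak limit is annihilated by `b`, hence is `0`, so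
`K (w n)` tends to `0` in norm. Thus `K` is as small as desired on vectors almost `b`-orthogonal to
a rich enough space (`exists_norm_K_le`). On such vectors `b` is nearly the elliptic form `a`, which
gives a uniform inf-sup bound (`exists_le_infSup`). The Galerkin error is exactly such a vector,
which gives quasi-orthogonality with any `ε` (`exists_quasiOrthogonal`).

The rate half needs only an inf-sup bound `γ` above some fixed mesh. Estimator reduction,
quasi-orthogonality with small `ε` and reliability combine into a contraction, so the squared
estimator converges linearly. Conversely, stability and discrete reliability show that a refinement
which reduces the estimator enough comes from a set satisfying the Dörfler criterion; this is where
`θ < thetaOpt` enters. Overlaying the current mesh with a near-best mesh of the approximation class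
bounds the number of marked elements by a negative power of the estimator. Mesh closure and a
geometric sum turn this into the rate (`exists_optimal_rates`). The converse compares each `N` with
the last mesh of the run having at most `N` extra elements.

In (iii) the meshes of a run need not refine the uniform mesh, so its inf-sup bound is not directly
available. `exists_infSup_transfer` carries the bound over to all spaces above a late space of the
run, with arbitrarily small loss. This loss is paid for by the strict inequality `θ < thetaOpt`. -/

noncomputable section

namespace AFEM

open MeasureTheory Filter Topology

/-! ### Weak limits along ultrafilters and compact operators -/

section Weak

variable {𝕜 : Type*} [RCLike 𝕜] {H : Type*} [NormedAddCommGroup H] [InnerProductSpace 𝕜 H]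

/-- Weak convergence in a Hilbert space along a filter. -/
def WeakTendsto (𝕜 : Type*) [RCLike 𝕜] {H : Type*} [NormedAddCommGroup H] [InnerProductSpace 𝕜 H]
    {ι : Type*} (x : ι → H) (l : Filter ι) (w : H) : Prop :=
  ∀ v : H, Tendsto (fun i => inner 𝕜 v (x i)) l (𝓝 (inner 𝕜 v w))

/-- Banach–Alaoglu in the dual, moved back by the Riesz isometry. Working along an ultrafilter
avoids extracting subsequences. -/
theorem exists_weakTendsto [CompleteSpace H] {ι : Type*} (l : Ultrafilter ι) {x : ι → H} {C : ℝ}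
    (hx : ∀ i, ‖x i‖ ≤ C) : ∃ w : H, WeakTendsto 𝕜 x l w := by
  let φ : ι → WeakDual 𝕜 H := fun i => StrongDual.toWeakDual (InnerProductSpace.toDual 𝕜 H (x i))
  have hc := WeakDual.isCompact_closedBall (0 : StrongDual 𝕜 H) C
  obtain ⟨ψ, -, hψ⟩ := hc.ultrafilter_le_nhds (l.map φ) (by
    rw [le_principal_iff]
    refine Filter.mem_map.2 (Filter.univ_mem' fun i => ?_)
    simpa [φ] using hx i)
  have hψ' : Tendsto φ l (𝓝 ψ) := hψ
  refine ⟨(InnerProductSpace.toDual 𝕜 H).symm (WeakDual.toStrongDual ψ), fun v => ?_⟩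
  have h1 : Tendsto (fun i => φ i v) l (𝓝 (ψ v)) := ((WeakDual.eval_continuous v).tendsto ψ).comp hψ'
  have h2 : Tendsto (fun i => inner 𝕜 (x i) v) l
      (𝓝 (inner 𝕜 ((InnerProductSpace.toDual 𝕜 H).symm (WeakDual.toStrongDual ψ)) v)) := by
    rw [InnerProductSpace.toDual_symm_apply]
    exact h1
  have h3 := (RCLike.continuous_conj.tendsto _).comp h2
  simpa only [Function.comp_def, inner_conj_symm] using h3

variable {ι : Type*} {l : Filter ι} {x : ι → H} {w : H}

theorem WeakTendsto.functional [CompleteSpace H] (hx : WeakTendsto 𝕜 x l w) (φ : H →L[𝕜] 𝕜) :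
    Tendsto (fun i => φ (x i)) l (𝓝 (φ w)) := by
  simpa [InnerProductSpace.toDual_symm_apply] using hx ((InnerProductSpace.toDual 𝕜 H).symm φ)

theorem WeakTendsto.map [CompleteSpace H] (hx : WeakTendsto 𝕜 x l w) (A : H →L[𝕜] H) :
    WeakTendsto 𝕜 (fun i => A (x i)) l (A w) := fun v =>
  hx.functional ((innerSL 𝕜 v).comp A)

theorem WeakTendsto.sub {y : ι → H} {z : H} (hx : WeakTendsto 𝕜 x l w) (hy : WeakTendsto 𝕜 y l z) :
    WeakTendsto 𝕜 (fun i => x i - y i) l (w - z) := fun v => by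
  simpa [inner_sub_right] using (hx v).sub (hy v)

theorem WeakTendsto.of_tendsto (hx : Tendsto x l (𝓝 w)) : WeakTendsto 𝕜 x l w := fun _ =>
  tendsto_const_nhds.inner hx

theorem WeakTendsto.inner_strong {g : ι → H} {z : H} {C : ℝ} (hx : WeakTendsto 𝕜 x l w)
    (hC : ∀ i, ‖x i‖ ≤ C) (hg : Tendsto g l (𝓝 z)) :
    Tendsto (fun i => inner 𝕜 (g i) (x i)) l (𝓝 (inner 𝕜 z w)) := by
  have h0 : Tendsto (fun i => ‖g i - z‖ * C) l (𝓝 0) := by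
    simpa using (tendsto_iff_norm_sub_tendsto_zero.1 hg).mul_const C
  have h1 : Tendsto (fun i => inner 𝕜 (g i - z) (x i)) l (𝓝 0) :=
    squeeze_zero_norm (fun i => (norm_inner_le_norm _ _).trans
      (mul_le_mul_of_nonneg_left (hC i) (norm_nonneg _))) h0
  simpa [inner_sub_left] using h1.add (hx z)

/-- A compact operator maps bounded weakly convergent families to convergent ones. -/
theorem WeakTendsto.compact [CompleteSpace H] {l : Ultrafilter ι} {C : ℝ}
    (hx : WeakTendsto 𝕜 x l w) (hC : ∀ i, ‖x i‖ ≤ C) {K : H →L[𝕜] H →L⋆[𝕜] 𝕜}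
    (hK : IsCompactOperator K) : Tendsto (fun i => K (x i)) l (𝓝 (K w)) := by
  have hc := hK.isCompact_closure_image_closedBall (f := (K : H →ₗ[𝕜] H →L⋆[𝕜] 𝕜)) C
  obtain ⟨k, -, hk⟩ := hc.ultrafilter_le_nhds (l.map fun i => K (x i)) (by
    rw [le_principal_iff]
    refine Filter.mem_map.2 (Filter.univ_mem' fun i => subset_closure ⟨x i, ?_, rfl⟩)
    simpa using hC i)
  have hk' : Tendsto (fun i => K (x i)) l (𝓝 k) := hk
  -- Compactness supplies some norm limit `k`; testing with each `v` identifies it through weak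
  -- convergence.
  suffices k = K w by rwa [← this]
  ext v
  have h1 : Tendsto (fun i => K (x i) v) l (𝓝 (k v)) :=
    ((ContinuousLinearMap.apply' 𝕜 (starRingEnd 𝕜) v).continuous.tendsto k).comp hk'
  exact tendsto_nhds_unique h1 (hx.functional (K.flip v : H →L[𝕜] 𝕜))

/-- The operator which represents a bounded sesquilinear form by the inner product. -/
def rieszOp [CompleteSpace H] (c : H →L[𝕜] H →L⋆[𝕜] 𝕜) : H →L[𝕜] H :=
  ContinuousLinearMap.adjoint (InnerProductSpace.continuousLinearMapOfBilin (𝕜 := 𝕜) c.flip)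

theorem inner_rieszOp [CompleteSpace H] (c : H →L[𝕜] H →L⋆[𝕜] 𝕜) (v w : H) :
    inner 𝕜 v (rieszOp c w) = c w v := by
  rw [rieszOp, ContinuousLinearMap.adjoint_inner_right,
    InnerProductSpace.continuousLinearMapOfBilin_apply]
  rfl

/-- Near-best approximations with slack `1 / (n + 1)` replace orthogonal projections, so the `X n`
need not be closed. -/
theorem exists_seq_mem_tendsto {X : ℕ → Submodule 𝕜 H} (hX : Monotone X)
    (hd : closure (⋃ n, (X n : Set H)) = Set.univ) (z : H) :
    ∃ p : ℕ → H, (∀ n, p n ∈ X n) ∧ Tendsto p atTop (𝓝 z) := by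
  have h1 : ∀ n : ℕ, ∃ p ∈ X n, dist z p < Metric.infDist z (X n) + 1 / ((n : ℝ) + 1) := fun n =>
    (Metric.infDist_lt_iff ⟨0, (X n).zero_mem⟩).1 (lt_add_of_pos_right _ (by positivity))
  choose p hp hpd using h1
  refine ⟨p, hp, ?_⟩
  have h2 : Tendsto (fun n => Metric.infDist z (X n : Set H)) atTop (𝓝 0) := by
    rw [Metric.tendsto_atTop]
    intro ε hε
    have hz : z ∈ closure (⋃ n, (X n : Set H)) := hd ▸ Set.mem_univ z
    obtain ⟨q, hq, hqd⟩ := Metric.mem_closure_iff.1 hz ε hε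
    obtain ⟨N, hN⟩ := Set.mem_iUnion.1 hq
    refine ⟨N, fun n hn => ?_⟩
    rw [Real.dist_eq, sub_zero, abs_of_nonneg Metric.infDist_nonneg]
    exact (Metric.infDist_le_dist_of_mem (hX hn hN)).trans_lt hqd
  have h3 : Tendsto (fun n : ℕ => Metric.infDist z (X n : Set H) + 1 / ((n : ℝ) + 1)) atTop (𝓝 0) := by
    simpa using h2.add tendsto_one_div_add_atTop_nhds_zero_nat
  rw [tendsto_iff_dist_tendsto_zero]
  refine squeeze_zero (fun _ => dist_nonneg) (fun n => ?_) h3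
  rw [dist_comm]
  exact (hpd n).le

end Weak

/-! ### Inf-sup stability and quasi-orthogonality -/

namespace Problem

variable {𝕜 : Type*} [RCLike 𝕜] {H : Type*} [NormedAddCommGroup H] [InnerProductSpace 𝕜 H]
  (P : Problem 𝕜 H)

theorem b_apply (w v : H) : P.b w v = P.a w v + P.K w v := rfl

theorem exists_of_infSup_lt {V : Submodule 𝕜 H} {γ : ℝ} (h : P.infSup V < ENNReal.ofReal γ) :
    ∃ W ∈ V, W ≠ 0 ∧ ∀ v ∈ V, ‖P.b W v‖ ≤ γ * ‖W‖ * ‖v‖ := by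
  simp only [infSup, iInf_lt_iff] at h
  obtain ⟨W, ⟨hW, hW0⟩, h⟩ := h
  refine ⟨W, hW, hW0, fun v hv => ?_⟩
  by_cases hv0 : v = 0
  · simp [hv0]
  have h1 : ENNReal.ofReal (‖P.b W v‖ / (‖W‖ * ‖v‖)) < ENNReal.ofReal γ :=
    lt_of_le_of_lt (le_iSup₂_of_le v ⟨hv, hv0⟩ le_rfl) h
  have h2 := (ENNReal.ofReal_lt_ofReal_iff_of_nonneg (by positivity)).1 h1
  have hp : 0 < ‖W‖ * ‖v‖ := mul_pos (norm_pos_iff.2 hW0) (norm_pos_iff.2 hv0)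
  rw [mul_assoc]
  exact ((div_lt_iff₀ hp).1 h2).le

theorem exists_of_le_infSup {V : Submodule 𝕜 H} {γ γ' : ℝ} (h : ENNReal.ofReal γ ≤ P.infSup V)
    (h0 : 0 ≤ γ') (hγ : γ' < γ) {W : H} (hW : W ∈ V) (hW0 : W ≠ 0) :
    ∃ v ∈ V, γ' * ‖W‖ * ‖v‖ < ‖P.b W v‖ := by
  have h1 : ENNReal.ofReal γ' < P.infSup V :=
    ((ENNReal.ofReal_lt_ofReal_iff_of_nonneg h0).2 hγ).trans_le h
  have h2 : P.infSup V ≤ ⨆ v ∈ {v : H | v ∈ V ∧ v ≠ 0},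
    ENNReal.ofReal (‖P.b W v‖ / (‖W‖ * ‖v‖)) := iInf₂_le_of_le W ⟨hW, hW0⟩ le_rfl
  have h3 := h1.trans_le h2
  simp only [lt_iSup_iff] at h3
  obtain ⟨v, ⟨hv, hv0⟩, h3⟩ := h3
  refine ⟨v, hv, ?_⟩
  have h4 := (ENNReal.ofReal_lt_ofReal_iff_of_nonneg h0).1 h3
  have hp : 0 < ‖W‖ * ‖v‖ := mul_pos (norm_pos_iff.2 hW0) (norm_pos_iff.2 hv0)
  rw [mul_assoc]
  exact (lt_div_iff₀ hp).1 h4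

theorem toReal_infSup_inv_le {V : Submodule 𝕜 H} {γ : ℝ} (hγ : 0 < γ)
    (h : ENNReal.ofReal γ ≤ P.infSup V) : (P.infSup V).toReal⁻¹ ≤ γ⁻¹ := by
  -- The value `⊤` (as for `V = ⊥`) has `toReal` equal to `0`, so its inverse is `0` and the bound
  -- is trivial.
  by_cases ht : P.infSup V = ⊤
  · simp [ht, hγ.le]
  · exact inv_anti₀ hγ ((ENNReal.ofReal_le_iff_le_toReal ht).1 h)

/-- A positive inf-sup constant yields unique solvability. -/
theorem solvable_of_le_infSup [CompleteSpace H] {V : Submodule 𝕜 H} [FiniteDimensional 𝕜 V] {γ : ℝ}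
    (hγ : 0 < γ) (h : ENNReal.ofReal γ ≤ P.infSup V) : P.Solvable V := by
  have hinj : ∀ W ∈ V, (∀ v ∈ V, P.b W v = 0) → W = 0 := by
    intro W hW h0
    by_contra hW0
    obtain ⟨v, hv, hlt⟩ := P.exists_of_le_infSup h le_rfl hγ hW hW0
    simp [h0 v hv] at hlt
  -- The compression of the Riesz operator of `b` to `V`: injective by the inf-sup bound, hence
  -- surjective in finite dimension. The load is written as `b u`.
  let L : V →ₗ[𝕜] V := (V.orthogonalProjectionOnto.comp ((rieszOp P.b).comp V.subtypeL) : V →L[𝕜] V)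
  have hL : ∀ (W : V) (v : V), inner 𝕜 v (L W) = P.b W v := by
    intro W v
    have : inner 𝕜 v (V.orthogonalProjectionOnto (rieszOp P.b W)) = P.b W v := by
      rw [Submodule.inner_orthogonalProjectionOnto_eq_of_mem_left, inner_rieszOp]
    exact this
  have hLi : Function.Injective L := by
    rw [injective_iff_map_eq_zero]
    intro W hW
    have := hinj W W.2 (fun v hv => by rw [← hL W ⟨v, hv⟩, hW, inner_zero_right])
    exact_mod_cast this
  obtain ⟨U, hU⟩ := LinearMap.injective_iff_surjective.1 hLi
    (V.orthogonalProjectionOnto (rieszOp P.b P.u))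
  refine ⟨U, ⟨U.2, fun v hv => ?_⟩, fun U' ⟨hU', hs⟩ => ?_⟩
  · rw [← hL U ⟨v, hv⟩, hU, Submodule.inner_orthogonalProjectionOnto_eq_of_mem_left, inner_rieszOp]
    exact P.solves v
  · refine sub_eq_zero.1 (hinj _ (V.sub_mem hU' U.2) fun v hv => ?_)
    rw [map_sub, sub_apply, hs v hv, ← hL U ⟨v, hv⟩, hU,
      Submodule.inner_orthogonalProjectionOnto_eq_of_mem_left, inner_rieszOp, sub_eq_zero]
    exact (P.solves v).symm

theorem galerkin_spec {V : Submodule 𝕜 H} (h : P.Solvable V) :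
    P.IsGalerkinSolution V (P.galerkin V) := by
  rw [galerkin, dif_pos h]
  exact h.choose_spec.1

theorem galerkin_orthogonal {V : Submodule 𝕜 H} (h : P.Solvable V) {v : H} (hv : v ∈ V) :
    P.b (P.u - P.galerkin V) v = 0 := by
  rw [map_sub, sub_apply, (P.galerkin_spec h).2 v hv, sub_eq_zero]
  exact P.solves v

/-- On elements which are almost `b`-orthogonal to a sufficiently rich space, the compact
perturbation is small. -/
theorem exists_norm_K_le [CompleteSpace H] {X : ℕ → Submodule 𝕜 H} (hX : Monotone X)
    (hd : closure (⋃ n, (X n : Set H)) = Set.univ) {δ : ℝ} (hδ : 0 < δ) :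
    ∃ (N : ℕ) (ρ : ℝ), 0 < ρ ∧ ∀ w : H, (∀ v ∈ X N, ‖P.b w v‖ ≤ ρ * ‖w‖ * ‖v‖) →
      ‖P.K w‖ ≤ δ * ‖w‖ := by
  by_contra hcon
  push Not at hcon
  have h1 : ∀ n : ℕ, ∃ w : H, ‖w‖ = 1 ∧ (∀ v ∈ X n, ‖P.b w v‖ ≤ 1 / ((n : ℝ) + 1) * ‖v‖) ∧
      δ < ‖P.K w‖ := by
    intro n
    obtain ⟨w, hw, hKw⟩ := hcon n (1 / ((n : ℝ) + 1)) (by positivity)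
    have hw0 : w ≠ 0 := by
      rintro rfl
      simp at hKw
    have hn : 0 < ‖w‖ := norm_pos_iff.2 hw0
    refine ⟨((‖w‖⁻¹ : ℝ) : 𝕜) • w, ?_, fun v hv => ?_, ?_⟩
    · rw [norm_smul, RCLike.norm_ofReal, abs_of_pos (inv_pos.2 hn), inv_mul_cancel₀ hn.ne']
    · rw [map_smul, smul_apply, norm_smul, RCLike.norm_ofReal,
        abs_of_pos (inv_pos.2 hn), inv_mul_le_iff₀ hn]
      calc _ ≤ _ := hw v hv
        _ = _ := by ring
    · rw [map_smul, norm_smul, RCLike.norm_ofReal, abs_of_pos (inv_pos.2 hn), lt_inv_mul_iff₀ hn,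
        mul_comm]
      exact hKw
  choose x hx1 hxb hxK using h1
  let l : Ultrafilter ℕ := Ultrafilter.of atTop
  have hl : (l : Filter ℕ) ≤ atTop := Ultrafilter.of_le atTop
  obtain ⟨w, hw⟩ := exists_weakTendsto (𝕜 := 𝕜) l (fun n => (hx1 n).le)
  -- For fixed `v` in some `X k`, the bound `1 / (n + 1)` applies for all `n ≥ k`; density then
  -- extends the identity to all `v`.
  have hz : ∀ v, P.b w v = 0 := by
    have hcl : IsClosed {v : H | P.b w v = 0} := isClosed_eq (P.b w).continuous continuous_const
    have hsub : (⋃ n, (X n : Set H)) ⊆ {v : H | P.b w v = 0} := by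
      intro v hv
      obtain ⟨k, hk⟩ := Set.mem_iUnion.1 hv
      have h2 : Tendsto (fun n => P.b (x n) v) l (𝓝 (P.b w v)) :=
        hw.functional (P.b.flip v : H →L[𝕜] 𝕜)
      have h3 : Tendsto (fun n => P.b (x n) v) atTop (𝓝 0) := by
        have h4 : Tendsto (fun n : ℕ => 1 / ((n : ℝ) + 1) * ‖v‖) atTop (𝓝 0) := by
          simpa using tendsto_one_div_add_atTop_nhds_zero_nat.mul_const ‖v‖
        refine squeeze_zero_norm' ?_ h4
        filter_upwards [eventually_ge_atTop k] with n hn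
        exact hxb n v (hX hn hk)
      exact tendsto_nhds_unique h2 (h3.mono_left hl)
    intro v
    have : v ∈ closure (⋃ n, (X n : Set H)) := hd ▸ Set.mem_univ v
    exact closure_minimal hsub hcl this
  have hw0 : w = 0 := (P.wellPosed w).2 hz
  have hK := (hw.compact (fun n => (hx1 n).le) P.compact).norm
  rw [hw0, map_zero, norm_zero] at hK
  exact absurd (ge_of_tendsto' hK fun n => (hxK n).le) (not_le.2 hδ)

/-- If the bound failed at `W`, then `‖K W‖ ≤ (α / 2) ‖W‖` and `|b(W, W)| ≤ (α / 4) ‖W‖²`, which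
together contradict ellipticity of `a`. -/
theorem exists_le_infSup [CompleteSpace H] {X : ℕ → Submodule 𝕜 H} (hX : Monotone X)
    (hd : closure (⋃ n, (X n : Set H)) = Set.univ) :
    ∃ (N : ℕ) (γ : ℝ), 0 < γ ∧ ∀ V : Submodule 𝕜 H, X N ≤ V → ENNReal.ofReal γ ≤ P.infSup V := by
  obtain ⟨α, hα, hell⟩ := P.elliptic
  obtain ⟨N, ρ, hρ, hN⟩ := P.exists_norm_K_le hX hd (δ := α / 2) (by positivity)
  refine ⟨N, min ρ (α / 4), by positivity, fun V hV => ?_⟩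
  by_contra hlt
  obtain ⟨W, hW, hW0, hb⟩ := P.exists_of_infSup_lt (not_le.1 hlt)
  have hn : 0 < ‖W‖ := norm_pos_iff.2 hW0
  have hK := hN W fun v hv => (hb v (hV hv)).trans
    (by gcongr; exact min_le_left _ _)
  have h1 : α * ‖W‖ ^ 2 ≤ ‖P.a W W‖ := (hell W).trans (RCLike.re_le_norm _)
  have h2 : P.a W W = P.b W W - P.K W W := by rw [b_apply]; ring
  have h3 : ‖P.a W W‖ ≤ α / 4 * ‖W‖ * ‖W‖ + α / 2 * ‖W‖ * ‖W‖ := by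
    rw [h2]
    refine (norm_sub_le _ _).trans (add_le_add ((hb W hW).trans ?_) ?_)
    · gcongr; exact min_le_right _ _
    · exact ((P.K W).le_opNorm W).trans (by gcongr)
  nlinarith [mul_pos hα (mul_pos hn hn)]

theorem energySq_le (v : H) : P.energySq v ≤ ‖P.a‖ * ‖v‖ ^ 2 := by
  refine (RCLike.re_le_norm _).trans ((P.a.le_opNorm₂ v v).trans ?_)
  rw [mul_assoc, sq]

theorem energySq_add (v w : H) :
    P.energySq (v + w) = P.energySq v + P.energySq w + 2 * RCLike.re (P.a v w) := by
  simp only [energySq, map_add, add_apply]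
  rw [P.hermitian w v, RCLike.conj_re]
  ring

theorem energySq_smul (t : ℝ) (v : H) : P.energySq ((t : 𝕜) • v) = t ^ 2 * P.energySq v := by
  simp only [energySq, map_smul, smul_apply, ContinuousLinearMap.map_smulₛₗ,
    RCLike.conj_ofReal, smul_eq_mul, RCLike.re_ofReal_mul]
  ring

/-- Quasi-orthogonality of Galerkin solutions in sufficiently rich spaces. -/
theorem exists_quasiOrthogonal [CompleteSpace H] {X : ℕ → Submodule 𝕜 H} (hX : Monotone X)
    (hd : closure (⋃ n, (X n : Set H)) = Set.univ) {ε : ℝ} (hε : 0 < ε) (hε' : ε < 1) :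
    ∃ N : ℕ, ∀ V V' : Submodule 𝕜 H, X N ≤ V → V ≤ V' → P.Solvable V → P.Solvable V' →
      P.energySq (P.u - P.galerkin V') + P.energySq (P.galerkin V' - P.galerkin V) ≤
        1 / (1 - ε) * P.energySq (P.u - P.galerkin V) := by
  obtain ⟨α, hα, hell⟩ := P.elliptic
  obtain ⟨N, ρ, hρ, hN⟩ := P.exists_norm_K_le hX hd (δ := ε * α) (by positivity)
  refine ⟨N, fun V V' hV hVV' hs hs' => ?_⟩
  set e := P.u - P.galerkin V'
  set d := P.galerkin V' - P.galerkin V with hdd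
  have hdV : d ∈ V' := V'.sub_mem (P.galerkin_spec hs').1 (hVV' (P.galerkin_spec hs).1)
  have horth : ∀ v ∈ V', P.b e v = 0 := fun v hv => P.galerkin_orthogonal hs' hv
  have hK : ‖P.K e‖ ≤ ε * α * ‖e‖ := hN e fun v hv => by
    rw [horth v (hVV' (hV hv)), norm_zero]
    positivity
  have hsum : P.u - P.galerkin V = e + d := by simp [e, d]
  rw [hsum, energySq_add, one_div, ← div_eq_inv_mul, le_div_iff₀ (by linarith)]
  -- Galerkin orthogonality `b(e, d) = 0` makes the mixed energy term a pure `K` term, and `‖K e‖`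
  -- is small because `e` is `b`-orthogonal to `X N`.
  have h1 : P.a e d = - P.K e d := by
    have := horth d hdV
    rw [b_apply] at this
    exact eq_neg_of_add_eq_zero_left this
  have h2 : |RCLike.re (P.a e d)| ≤ ε * α * ‖e‖ * ‖d‖ := by
    refine (RCLike.abs_re_le_norm _).trans ?_
    rw [h1, norm_neg]
    exact ((P.K e).le_opNorm d).trans (by gcongr)
  have h3 := (abs_le.1 h2).1
  have h4 : α * ‖e‖ ^ 2 ≤ P.energySq e := hell e
  have h5 : α * ‖d‖ ^ 2 ≤ P.energySq d := hell d
  have h6 : 0 ≤ ε * α * (‖e‖ - ‖d‖) ^ 2 := by positivity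
  nlinarith

/-- Adjoining `w` to `F` keeps the space finite-dimensional, so its inf-sup bound applies to `w`
itself. -/
theorem gamma_mul_norm_le_of_infSup {F : Submodule 𝕜 H} [FiniteDimensional 𝕜 F] {γ : ℝ}
    (hF : ∀ V : Submodule 𝕜 H, FiniteDimensional 𝕜 V → F ≤ V → ENNReal.ofReal γ ≤ P.infSup V)
    (w : H) : γ * ‖w‖ ≤ ‖P.b w‖ := by
  by_cases hw : w = 0
  · simp [hw]
  by_contra! hlt
  have hn : 0 < ‖w‖ := norm_pos_iff.2 hw
  have hmem : w ∈ F ⊔ Submodule.span 𝕜 {w} :=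
    Submodule.mem_sup_right (Submodule.mem_span_singleton_self w)
  obtain ⟨v, -, hv⟩ := P.exists_of_le_infSup (γ' := ‖P.b w‖ / ‖w‖)
    (hF (F ⊔ Submodule.span 𝕜 {w}) inferInstance le_sup_left) (by positivity)
    ((div_lt_iff₀ hn).2 hlt) hmem hw
  rw [div_mul_cancel₀ _ hn.ne'] at hv
  exact absurd ((P.b w).le_opNorm v) (not_le.2 hv)

theorem norm_le_norm_rieszOp [CompleteSpace H] (c : H →L[𝕜] H →L⋆[𝕜] 𝕜) (w : H) :
    ‖c w‖ ≤ ‖rieszOp c w‖ := by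
  refine ContinuousLinearMap.opNorm_le_bound _ (norm_nonneg _) fun v => ?_
  rw [← inner_rieszOp, mul_comm]
  exact norm_inner_le_norm _ _

/-- If the full form is bounded below by `γ`, then so is the principal part on weakly null
families. -/
theorem gamma_mul_limit_le [CompleteSpace H] {γ : ℝ} (hγ : 0 < γ)
    (hb : ∀ w, γ * ‖w‖ ≤ ‖P.b w‖) {ι : Type*} {l : Ultrafilter ι} {y : ι → H} {C Y A : ℝ}
    (hC : ∀ i, ‖y i‖ ≤ C) (hy : WeakTendsto 𝕜 y l 0)
    (hY : Tendsto (fun i => ‖y i‖ ^ 2) l (𝓝 Y))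
    (hA : Tendsto (fun i => P.energySq (y i)) l (𝓝 A)) : γ * Y ≤ A := by
  obtain ⟨α, hα, hell⟩ := P.elliptic
  have hunit : IsUnit (rieszOp P.a) := by
    refine ContinuousLinearMap.isUnit_of_forall_le_norm_inner_map _ (c := ⟨α, hα.le⟩) hα fun x => ?_
    rw [norm_inner_symm, inner_rieszOp]
    calc ‖x‖ ^ 2 * α = α * ‖x‖ ^ 2 := mul_comm _ _
      _ ≤ _ := hell x
      _ ≤ _ := RCLike.re_le_norm _
  obtain ⟨B, hB⟩ := hunit.exists_right_inv
  have hBy : ∀ z, rieszOp P.a (B z) = z := fun z => congrArg (fun f : H →L[𝕜] H => f z) hB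
  -- Thus `a(x i, ·)` is represented by `y i`. As `K (x i)` tends to `0`, the lower bound on `b`
  -- gives `γ ‖x i‖ ≤ ‖y i‖ + o(1)`.
  let x : ι → H := fun i => B (y i)
  have hxw : WeakTendsto 𝕜 x l 0 := by simpa using hy.map B
  have hxC : ∀ i, ‖x i‖ ≤ ‖B‖ * C := fun i =>
    (B.le_opNorm _).trans (mul_le_mul_of_nonneg_left (hC i) (norm_nonneg _))
  have hK : Tendsto (fun i => ‖P.K (x i)‖) l (𝓝 0) := by
    simpa using (hxw.compact hxC P.compact).norm
  have hax : ∀ i v, P.a (x i) v = inner 𝕜 v (y i) := fun i v => by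
    rw [← inner_rieszOp, hBy]
  have hbound : ∀ i, γ * ‖x i‖ ≤ ‖y i‖ + ‖P.K (x i)‖ := fun i => by
    refine (hb _).trans ((norm_add_le (P.a (x i)) (P.K (x i))).trans (add_le_add_left ?_ _))
    refine ContinuousLinearMap.opNorm_le_bound _ (norm_nonneg _) fun v => ?_
    rw [hax, mul_comm]
    exact norm_inner_le_norm _ _
  have hkey : ∀ i, γ * ‖y i‖ ^ 2 ≤ P.energySq (y i) + γ * (‖P.K (x i)‖ * C) := fun i => by
    -- Nonnegativity of the energy of `x - γ⁻¹ y` bounds `a(y, y)` from below by `2 γ ‖y‖² - γ² a(x,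
    -- x)`, and `a(x, x) ≤ ‖x‖ ‖y‖`.
    have h0 : 0 ≤ P.energySq (x i + ((-γ⁻¹ : ℝ) : 𝕜) • y i) :=
      le_trans (by positivity) (hell _)
    rw [energySq_add, energySq_smul, ContinuousLinearMap.map_smulₛₗ, RCLike.conj_ofReal,
      smul_eq_mul, RCLike.re_ofReal_mul, hax, inner_self_eq_norm_sq] at h0
    have h1 : P.energySq (x i) ≤ ‖x i‖ * ‖y i‖ := by
      rw [energySq, hax]
      exact (RCLike.re_le_norm _).trans (norm_inner_le_norm _ _)
    have h2 : γ * (‖x i‖ * ‖y i‖) ≤ ‖y i‖ ^ 2 + ‖P.K (x i)‖ * C := by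
      calc γ * (‖x i‖ * ‖y i‖) = (γ * ‖x i‖) * ‖y i‖ := by ring
        _ ≤ (‖y i‖ + ‖P.K (x i)‖) * ‖y i‖ := by gcongr; exact hbound i
        _ = ‖y i‖ ^ 2 + ‖P.K (x i)‖ * ‖y i‖ := by ring
        _ ≤ _ := by gcongr; exact hC i
    have h3 : 0 ≤ γ ^ 2 * (‖x i‖ * ‖y i‖ + (-γ⁻¹) ^ 2 * P.energySq (y i) +
      2 * (-γ⁻¹ * ‖y i‖ ^ 2)) := mul_nonneg (sq_nonneg _) (h0.trans (by linarith))
    have h4 : γ ^ 2 * (‖x i‖ * ‖y i‖ + (-γ⁻¹) ^ 2 * P.energySq (y i) +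
      2 * (-γ⁻¹ * ‖y i‖ ^ 2)) = γ * (γ * (‖x i‖ * ‖y i‖)) + P.energySq (y i)
        - 2 * γ * ‖y i‖ ^ 2 := by
      field_simp
      ring
    rw [h4] at h3
    have h5 := mul_le_mul_of_nonneg_left h2 hγ.le
    nlinarith
  have hlim : Tendsto (fun i => P.energySq (y i) + γ * (‖P.K (x i)‖ * C)) l (𝓝 A) := by
    simpa using hA.add ((hK.mul_const C).const_mul γ)
  exact le_of_tendsto_of_tendsto' (hY.const_mul γ) hlim hkey

theorem exists_tendsto_of_bounded {ι : Type*} (l : Ultrafilter ι) {t : ι → ℝ} {C : ℝ}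
    (h0 : ∀ i, 0 ≤ t i) (hC : ∀ i, t i ≤ C) : ∃ s, Tendsto t l (𝓝 s) := by
  obtain ⟨s, -, hs⟩ := (isCompact_Icc (a := (0 : ℝ)) (b := C)).ultrafilter_le_nhds (l.map t) (by
    rw [le_principal_iff]
    exact Filter.mem_map.2 (Filter.univ_mem' fun i => ⟨h0 i, hC i⟩))
  exact ⟨s, hs⟩

/-- A uniform inf-sup bound above one finite-dimensional space carries over, up to an arbitrarily
small loss, to all spaces above a sufficiently rich member of a dense sequence. -/
theorem exists_infSup_transfer [CompleteSpace H] {F : Submodule 𝕜 H} [FiniteDimensional 𝕜 F]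
    {γ γ' : ℝ} (hγ : 0 < γ') (hγ' : γ' < γ)
    (hF : ∀ V : Submodule 𝕜 H, FiniteDimensional 𝕜 V → F ≤ V → ENNReal.ofReal γ ≤ P.infSup V)
    {X : ℕ → Submodule 𝕜 H} (hX : Monotone X)
    (hd : closure (⋃ n, (X n : Set H)) = Set.univ) :
    ∃ N : ℕ, ∀ V : Submodule 𝕜 H, X N ≤ V → ENNReal.ofReal γ' ≤ P.infSup V := by
  have hb := P.gamma_mul_norm_le_of_infSup hF
  have hγ0 : 0 < γ := hγ.trans hγ'
  by_contra hcon
  push Not at hcon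
  have h1 : ∀ n : ℕ, ∃ V : Submodule 𝕜 H, X n ≤ V ∧ ∃ W ∈ V, ‖W‖ = 1 ∧
      ∀ v ∈ V, ‖P.b W v‖ ≤ γ' * ‖v‖ := by
    intro n
    obtain ⟨V, hV, hlt⟩ := hcon n
    obtain ⟨w, hw, hw0, hwb⟩ := P.exists_of_infSup_lt hlt
    have hn : 0 < ‖w‖ := norm_pos_iff.2 hw0
    refine ⟨V, hV, ((‖w‖⁻¹ : ℝ) : 𝕜) • w, V.smul_mem _ hw, ?_, fun v hv => ?_⟩
    · rw [norm_smul, RCLike.norm_ofReal, abs_of_pos (inv_pos.2 hn), inv_mul_cancel₀ hn.ne']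
    · rw [map_smul, smul_apply, norm_smul, RCLike.norm_ofReal,
        abs_of_pos (inv_pos.2 hn), inv_mul_le_iff₀ hn]
      calc _ ≤ _ := hwb v hv
        _ = _ := by ring
  choose V hXV W hWV hW1 hWb using h1
  let l : Ultrafilter ℕ := Ultrafilter.of atTop
  have hl : (l : Filter ℕ) ≤ atTop := Ultrafilter.of_le atTop
  obtain ⟨w, hw⟩ := exists_weakTendsto (𝕜 := 𝕜) l (fun n => (hW1 n).le)
  let B := rieszOp P.b
  let g := B w
  obtain ⟨p, hpX, hp'⟩ := exists_seq_mem_tendsto hX hd w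
  obtain ⟨q, hqX, hq'⟩ := exists_seq_mem_tendsto hX hd g
  have hp : Tendsto p l (𝓝 w) := hp'.mono_left hl
  have hq : Tendsto q l (𝓝 g) := hq'.mono_left hl
  obtain ⟨Cp, hCp⟩ : ∃ C, ∀ n, ‖p n‖ ≤ C := by
    obtain ⟨C, hC⟩ := (Metric.isBounded_range_of_tendsto p hp').exists_norm_le
    exact ⟨C, fun n => hC _ ⟨n, rfl⟩⟩
  -- `W n` splits into a strongly convergent part `p n ∈ X n ≤ V n` and a weakly null part `y n ∈ V
  -- n`. Mixed terms vanish in the limit.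
  let y : ℕ → H := fun n => W n - p n
  have hyC : ∀ n, ‖y n‖ ≤ 1 + Cp := fun n =>
    (norm_sub_le _ _).trans (add_le_add (hW1 n).le (hCp n))
  have hy : WeakTendsto 𝕜 y l 0 := by simpa using hw.sub (WeakTendsto.of_tendsto hp)
  obtain ⟨Y, hY⟩ := exists_tendsto_of_bounded l (t := fun n => ‖y n‖ ^ 2) (C := (1 + Cp) ^ 2)
    (fun n => sq_nonneg _) (fun n => by gcongr; exact hyC n)
  obtain ⟨α, hα, hell⟩ := P.elliptic
  obtain ⟨A, hA⟩ := exists_tendsto_of_bounded l (t := fun n => P.energySq (y n))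
    (C := ‖P.a‖ * (1 + Cp) ^ 2) (fun n => le_trans (by positivity) (hell _))
    (fun n => (P.energySq_le _).trans (by gcongr; exact hyC n))
  have hYA : γ * Y ≤ A := P.gamma_mul_limit_le hγ0 hb hyC hy hY hA
  have hre : Continuous (RCLike.re : 𝕜 → ℝ) := RCLike.continuous_re
  have hnorm : ‖w‖ ^ 2 + Y = 1 := by
    have h2 : Tendsto (fun n => ‖p n‖ ^ 2 + 2 * RCLike.re (inner 𝕜 (p n) (y n)) + ‖y n‖ ^ 2) l
        (𝓝 (‖w‖ ^ 2 + 2 * RCLike.re (inner 𝕜 w (0 : H)) + Y)) :=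
      ((hp.norm.pow 2).add (((hre.tendsto _).comp (hy.inner_strong hyC hp)).const_mul 2)).add hY
    have h3 : ∀ n, ‖p n‖ ^ 2 + 2 * RCLike.re (inner 𝕜 (p n) (y n)) + ‖y n‖ ^ 2 = 1 := fun n => by
      rw [← norm_add_sq (𝕜 := 𝕜)]
      simp [y, hW1 n]
    simp only [h3, inner_zero_right, map_zero, mul_zero, add_zero] at h2
    exact tendsto_nhds_unique h2 tendsto_const_nhds
  -- This test function imitates the Riesz representer of `b (W n)` inside `V n`: `q n` approximates
  -- `B w`, while on the weakly null part the factor `γ` matches the bound `γ * Y ≤ A`.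
  let v : ℕ → H := fun n => q n + (γ : 𝕜) • y n
  have hvV : ∀ n, v n ∈ V n := fun n =>
    (V n).add_mem (hXV n (hqX n)) ((V n).smul_mem _ ((V n).sub_mem (hWV n) (hXV n (hpX n))))
  have hvn : Tendsto (fun n => ‖v n‖ ^ 2) l (𝓝 (‖g‖ ^ 2 + γ ^ 2 * Y)) := by
    have h2 : Tendsto (fun n => ‖q n‖ ^ 2 + 2 * (γ * RCLike.re (inner 𝕜 (q n) (y n))) +
        γ ^ 2 * ‖y n‖ ^ 2) l
        (𝓝 (‖g‖ ^ 2 + 2 * (γ * RCLike.re (inner 𝕜 g (0 : H))) + γ ^ 2 * Y)) :=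
      ((hq.norm.pow 2).add ((((hre.tendsto _).comp
        (hy.inner_strong hyC hq)).const_mul γ).const_mul 2)).add (hY.const_mul _)
    simp only [inner_zero_right, map_zero, mul_zero, add_zero] at h2
    refine h2.congr fun n => ?_
    simp only [v]
    rw [norm_add_sq (𝕜 := 𝕜), inner_smul_right, RCLike.re_ofReal_mul, norm_smul,
      RCLike.norm_ofReal, mul_pow, sq_abs]
  have hbq : Tendsto (fun n => RCLike.re (P.b (W n) (q n))) l (𝓝 (‖g‖ ^ 2)) := by
    have h2 := (hre.tendsto _).comp ((hw.map B).inner_strong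
      (C := ‖B‖ * 1) (fun n => (B.le_opNorm _).trans (by gcongr; exact (hW1 n).le)) hq)
    rw [inner_self_eq_norm_sq] at h2
    refine h2.congr fun n => ?_
    simp only [Function.comp, B, inner_rieszOp]
  -- The term `b(p n, y n)` vanishes because `B (p n)` converges strongly, and `K (y n) (y n)`
  -- vanishes by compactness; only `a(y n, y n)` survives.
  have hby : Tendsto (fun n => RCLike.re (P.b (W n) (y n))) l (𝓝 A) := by
    have h2 : Tendsto (fun n => RCLike.re (P.b (p n) (y n))) l (𝓝 0) := by
      have h3 := (hre.tendsto _).comp (hy.inner_strong hyC ((B.continuous.tendsto w).comp hp))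
      rw [inner_zero_right, map_zero] at h3
      refine h3.congr fun n => ?_
      simp only [Function.comp, B]
      rw [← inner_conj_symm, inner_rieszOp, RCLike.conj_re]
    have h4 : Tendsto (fun n => RCLike.re (P.K (y n) (y n))) l (𝓝 0) := by
      have h5 : Tendsto (fun n => ‖P.K (y n)‖ * (1 + Cp)) l (𝓝 0) := by
        simpa using ((hy.compact hyC P.compact).norm).mul_const (1 + Cp)
      refine squeeze_zero_norm (fun n => ?_) h5
      rw [Real.norm_eq_abs]
      refine (RCLike.abs_re_le_norm _).trans (((P.K (y n)).le_opNorm _).trans ?_)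
      gcongr
      exact hyC n
    have h6 := (h2.add hA).add h4
    rw [zero_add, add_zero] at h6
    refine h6.congr fun n => ?_
    have h7 : W n = p n + y n := by simp [y]
    rw [energySq, ← map_add, ← map_add, add_assoc, ← b_apply, ← add_apply, ← map_add, ← h7]
  have hbv : Tendsto (fun n => RCLike.re (P.b (W n) (v n))) l (𝓝 (‖g‖ ^ 2 + γ * A)) := by
    refine (hbq.add (hby.const_mul γ)).congr fun n => ?_
    simp only [v]
    rw [map_add, ContinuousLinearMap.map_smulₛₗ, RCLike.conj_ofReal, map_add, smul_eq_mul,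
      RCLike.re_ofReal_mul]
  have hsq : ∀ n, RCLike.re (P.b (W n) (v n)) ≤ γ' * Real.sqrt (‖v n‖ ^ 2) := fun n => by
    rw [Real.sqrt_sq (norm_nonneg _)]
    exact (RCLike.re_le_norm _).trans (hWb n _ (hvV n))
  have hfin := le_of_tendsto_of_tendsto' hbv (hvn.sqrt.const_mul γ') hsq
  have hgw : γ * ‖w‖ ≤ ‖g‖ := (hb w).trans (norm_le_norm_rieszOp _ _)
  have hgw2 : γ ^ 2 * ‖w‖ ^ 2 ≤ ‖g‖ ^ 2 := by
    rw [← mul_pow]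
    gcongr
  -- `S` is the limit of `‖v n‖²` and a lower bound for the limit of `b(W n, v n)`. Hence `√S ≤ γ'`,
  -- whereas `‖w‖² + Y = 1` gives `√S ≥ γ`.
  set S := ‖g‖ ^ 2 + γ ^ 2 * Y with hS
  have hSγ : γ ^ 2 ≤ S := by
    calc γ ^ 2 = γ ^ 2 * (‖w‖ ^ 2 + Y) := by rw [hnorm, mul_one]
      _ ≤ _ := by rw [mul_add]; linarith
  have hS1 : S ≤ γ' * Real.sqrt S := by
    refine le_trans ?_ hfin
    rw [hS]
    nlinarith
  have hS0 : 0 < S := lt_of_lt_of_le (by positivity) hSγ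
  have hr : γ ≤ Real.sqrt S := Real.le_sqrt_of_sq_le hSγ
  have hss := Real.mul_self_sqrt hS0.le
  have hrp : 0 < Real.sqrt S := hγ0.trans_le hr
  have : Real.sqrt S ≤ γ' := le_of_mul_le_mul_right (hss.trans_le hS1) hrp
  linarith

end Problem

/-! ### Counting elements under refinement; meshes of a run -/

section Meshes

variable {d : ℕ} {Ω : Set (EuclideanSpace ℝ (Fin d))}

namespace Triangulation

variable {T T' T'' : Triangulation Ω} {E E' : Set (EuclideanSpace ℝ (Fin d))}

theorem mem_sons : E' ∈ T.sons E ↔ E' ∈ T.elems ∧ E' ⊆ E := by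
  classical
  simp [sons]

theorem eq_of_subset_of_subset {E₁ E₂ F : Set (EuclideanSpace ℝ (Fin d))} (h₁ : E₁ ∈ T.elems)
    (h₂ : E₂ ∈ T.elems) (hF : 0 < volume F) (hF₁ : F ⊆ E₁) (hF₂ : F ⊆ E₂) : E₁ = E₂ := by
  by_contra hne
  have h := measure_mono (μ := volume) (Set.subset_inter hF₁ hF₂)
  rw [T.overlap E₁ h₁ E₂ h₂ hne] at h
  exact absurd h (not_le.2 hF)

theorem Subdivides.rfl : T.Subdivides T := fun E hE => by
  apply Set.Subset.antisymm
  · exact Set.subset_biUnion_of_mem (u := fun E' => E') (mem_sons.2 ⟨hE, subset_rfl⟩)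
  · exact Set.iUnion₂_subset fun E' hE' => (mem_sons.1 hE').2

theorem Subdivides.trans (h : T'.Subdivides T) (h' : T''.Subdivides T') : T''.Subdivides T := by
  intro E hE
  apply Set.Subset.antisymm
  · intro x hx
    rw [h E hE] at hx
    obtain ⟨E', hE', hx⟩ := Set.mem_iUnion₂.1 hx
    rw [h' E' (mem_sons.1 hE').1] at hx
    obtain ⟨E'', hE'', hx⟩ := Set.mem_iUnion₂.1 hx
    exact Set.mem_iUnion₂.2 ⟨E'', mem_sons.2 ⟨(mem_sons.1 hE'').1,
      (mem_sons.1 hE'').2.trans (mem_sons.1 hE').2⟩, hx⟩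
  · exact Set.iUnion₂_subset fun E' hE' => (mem_sons.1 hE').2

theorem pairwiseDisjoint_sons :
    Set.PairwiseDisjoint (T.elems : Set (Set (EuclideanSpace ℝ (Fin d)))) T'.sons := by
  classical
  intro E₁ h₁ E₂ h₂ hne
  rw [Function.onFun, Finset.disjoint_left]
  intro F hF₁ hF₂
  exact hne (eq_of_subset_of_subset h₁ h₂ (T'.volume_pos F (mem_sons.1 hF₁).1)
    (mem_sons.1 hF₁).2 (mem_sons.1 hF₂).2)

-- A fine element contained in no coarse one would be covered by its overlaps with the other fine
-- elements, hence would be a null set.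
open Classical in
theorem Subdivides.biUnion_sons (h : T'.Subdivides T) : T.elems.biUnion T'.sons = T'.elems := by
  apply Finset.Subset.antisymm
  · exact Finset.biUnion_subset.2 fun E _ F hF => (mem_sons.1 hF).1
  · intro F hF
    by_contra hcon
    have hnot : ∀ E ∈ T.elems, ¬ F ⊆ E := fun E hE hFE =>
      hcon (Finset.mem_biUnion.2 ⟨E, hE, mem_sons.2 ⟨hF, hFE⟩⟩)
    have hcov : F ⊆ ⋃ G ∈ T'.elems.erase F, F ∩ G := by
      intro x hx
      have hx' : x ∈ ⋃ E ∈ T.elems, E := by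
        rw [T.cover, ← T'.cover]
        exact Set.mem_iUnion₂.2 ⟨F, hF, hx⟩
      obtain ⟨E, hE, hxE⟩ := Set.mem_iUnion₂.1 hx'
      rw [h E hE] at hxE
      obtain ⟨G, hG, hxG⟩ := Set.mem_iUnion₂.1 hxE
      refine Set.mem_iUnion₂.2 ⟨G, Finset.mem_erase.2 ⟨?_, (mem_sons.1 hG).1⟩, hx, hxG⟩
      rintro rfl
      exact hnot E hE (mem_sons.1 hG).2
    have h0 : volume (⋃ G ∈ T'.elems.erase F, F ∩ G) = 0 := by
      refine (measure_biUnion_null_iff (Finset.countable_toSet _)).2 fun G hG => ?_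
      obtain ⟨hne, hG⟩ := Finset.mem_erase.1 hG
      exact T'.overlap F hF G hG hne.symm
    exact absurd (measure_mono_null hcov h0) (T'.volume_pos F hF).ne'

theorem Subdivides.card_eq_sum (h : T'.Subdivides T) :
    T'.card = ∑ E ∈ T.elems, (T'.sons E).card := by
  classical
  rw [card, ← h.biUnion_sons, Finset.card_biUnion pairwiseDisjoint_sons]

theorem Subdivides.sons_nonempty (h : T'.Subdivides T) (hE : E ∈ T.elems) :
    (T'.sons E).Nonempty := by
  rw [Finset.nonempty_iff_ne_empty]
  intro h0
  have h1 := h E hE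
  rw [h0] at h1
  have h2 := T.volume_pos E hE
  rw [h1] at h2
  simp at h2

/-- A single son would have to equal `E`. This works for arbitrary subdivisions, whereas `SonBounds`
speaks of one refinement step only. -/
theorem Subdivides.two_le_card_sons (h : T'.Subdivides T) (hE : E ∈ T.elems) (hE' : E ∉ T'.elems) :
    2 ≤ (T'.sons E).card := by
  by_contra hlt
  have h1 : (T'.sons E).card = 1 := by
    have := (h.sons_nonempty hE).card_pos
    omega
  obtain ⟨F, hF⟩ := Finset.card_eq_one.1 h1
  have h2 := h E hE
  rw [hF] at h2
  simp only [Finset.mem_singleton, Set.iUnion_iUnion_eq_left] at h2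
  have h3 : F ∈ T'.sons E := by simp [hF]
  exact hE' (h2 ▸ (mem_sons.1 h3).1)

theorem sons_of_mem (hE' : E ∈ T'.elems) : T'.sons E = {E} := by
  ext F
  rw [mem_sons, Finset.mem_singleton]
  constructor
  · rintro ⟨hF, hFE⟩
    exact eq_of_subset_of_subset hF hE' (T'.volume_pos F hF) subset_rfl hFE
  · rintro rfl
    exact ⟨hE', subset_rfl⟩

theorem mem_sdiff : E ∈ T.sdiff T' ↔ E ∈ T.elems ∧ E ∉ T'.elems := by
  classical
  simp [sdiff]

/-- Each refined element increases the number of elements by at least one. -/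
theorem Subdivides.card_add_card_sdiff_le (h : T'.Subdivides T) :
    T.card + (T.sdiff T').card ≤ T'.card := by
  classical
  rw [h.card_eq_sum, card, Finset.card_eq_sum_ones, sdiff, Finset.card_eq_sum_ones,
    ← Finset.filter_notMem_eq_sdiff, Finset.sum_filter, ← Finset.sum_add_distrib]
  refine Finset.sum_le_sum fun E hE => ?_
  split_ifs with hE'
  · exact (h.sons_nonempty hE).card_pos
  · exact h.two_le_card_sons hE hE'

end Triangulation

namespace RefinementStrategy

variable {S : RefinementStrategy Ω} {T T' : Triangulation Ω}

theorem Refines.conforming (h : S.Refines T T') (hT : S.Conforming T) : S.Conforming T' := by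
  induction h with
  | refl => exact hT
  | tail _ h ih =>
    obtain ⟨M, hM, rfl⟩ := h
    exact S.conforming_refine _ M ih hM

theorem Refines.subdivides (h : S.Refines T T') (hT : S.Conforming T) : T'.Subdivides T := by
  induction h with
  | refl => exact Triangulation.Subdivides.rfl
  | tail h' h ih =>
    obtain ⟨M, hM, rfl⟩ := h
    exact ih.trans (S.subdivides_refine _ M (Refines.conforming h' hT) hM)

theorem refines_refine {M : Finset (Set (EuclideanSpace ℝ (Fin d)))} (hM : M ⊆ T.elems) :
    S.Refines T (S.refine T M) := Relation.ReflTransGen.single ⟨M, hM, rfl⟩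

end RefinementStrategy

namespace Discretization

variable {𝕜 : Type*} [RCLike 𝕜] {H : Type*} [NormedAddCommGroup H] [InnerProductSpace 𝕜 H]
  {D : Discretization 𝕜 H Ω} {T T' : Triangulation Ω}

theorem Admissible.conforming (h : D.Admissible T) : D.S.Conforming T :=
  RefinementStrategy.Refines.conforming h D.conforming_T0

theorem Admissible.trans (h : D.Admissible T) (h' : D.S.Refines T T') : D.Admissible T' :=
  Relation.ReflTransGen.trans h h'

theorem Admissible.card_add_card_sdiff_le (h : D.Admissible T) (h' : D.S.Refines T T') :
    T.card + (T.sdiff T').card ≤ T'.card :=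
  (h'.subdivides h.conforming).card_add_card_sdiff_le

theorem Admissible.card_le (h : D.Admissible T) (h' : D.S.Refines T T') : T.card ≤ T'.card :=
  (Nat.le_add_right _ _).trans (h.card_add_card_sdiff_le h')

/-- The factor `Cson + 1` bounds the sons of refined elements and the single son of a kept one,
without requiring `1 ≤ Cson`. -/
theorem SonBounds.card_refine_le {Cson : ℕ} (hsons : D.SonBounds Cson) (h : D.Admissible T)
    {M : Finset (Set (EuclideanSpace ℝ (Fin d)))} (hM : M ⊆ T.elems) :
    (D.S.refine T M).card ≤ (Cson + 1) * T.card := by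
  rw [(D.S.subdivides_refine T M h.conforming hM).card_eq_sum, Triangulation.card, mul_comm,
    ← smul_eq_mul]
  refine Finset.sum_le_card_nsmul _ _ _ fun E hE => ?_
  by_cases hE' : E ∈ (D.S.refine T M).elems
  · rw [Triangulation.sons_of_mem hE']
    simp
  · exact (hsons T M h hM E (Triangulation.mem_sdiff.2 ⟨hE, hE'⟩)).2.trans (Nat.le_succ _)

theorem admissible_uniform (m : ℕ) : D.Admissible (D.uniform m) := by
  induction m with
  | zero => exact Relation.ReflTransGen.refl
  | succ m ih =>
    rw [uniform, Function.iterate_succ_apply']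
    exact ih.trans (RefinementStrategy.refines_refine subset_rfl)

theorem uniform_succ (m : ℕ) :
    D.uniform (m + 1) = D.S.refine (D.uniform m) (D.uniform m).elems := by
  rw [uniform, Function.iterate_succ_apply']
  rfl

theorem monotone_X_uniform : Monotone fun m => D.X (D.uniform m) :=
  monotone_nat_of_le_succ fun m => D.nested _ _ (admissible_uniform m) (by
    rw [uniform_succ]
    exact RefinementStrategy.refines_refine subset_rfl)

theorem dense_uniform : closure (⋃ m, (D.X (D.uniform m) : Set H)) = Set.univ :=
  D.dense (fun m => D.uniform m) (fun m => (D.uniform m).elems) rfl (fun _ => subset_rfl)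
    (fun m => uniform_succ m) (by simpa using Set.infinite_univ)

end Discretization

namespace AdaptiveRun

variable {𝕜 : Type*} [RCLike 𝕜] {H : Type*} [NormedAddCommGroup H] [InnerProductSpace 𝕜 H]
  {P : Problem 𝕜 H} {D : Discretization 𝕜 H Ω} {θ Cmark : ℝ} (r : AdaptiveRun P D θ Cmark)

theorem refines_succ (l : ℕ) : D.S.Refines (r.mesh l) (r.mesh (l + 1)) := by
  rw [r.mesh_succ]
  exact RefinementStrategy.refines_refine (r.marked_subset l)

theorem refines_of_le {k l : ℕ} (h : k ≤ l) : D.S.Refines (r.mesh k) (r.mesh l) := by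
  induction l, h using Nat.le_induction with
  | base => exact Relation.ReflTransGen.refl
  | succ l _ ih => exact Relation.ReflTransGen.trans ih (r.refines_succ l)

theorem admissible (l : ℕ) : D.Admissible (r.mesh l) := by
  have := r.refines_of_le (Nat.zero_le l)
  rwa [r.mesh_zero] at this

theorem monotone_X : Monotone fun l => D.X (r.mesh l) := fun _ _ h =>
  D.nested _ _ (r.admissible _) (r.refines_of_le h)

theorem marked_subset_sdiff (l : ℕ) : r.marked l ⊆ (r.mesh l).sdiff (r.mesh (l + 1)) := by
  rw [r.mesh_succ]
  exact D.S.marked_refined _ _ (r.admissible l).conforming (r.marked_subset l)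

theorem card_add_card_marked_le (l : ℕ) :
    (r.mesh l).card + (r.marked l).card ≤ (r.mesh (l + 1)).card :=
  (Nat.add_le_add_left (Finset.card_le_card (r.marked_subset_sdiff l)) _).trans
    ((r.admissible l).card_add_card_sdiff_le (r.refines_succ l))

/-- Makes the marking history before `l₆` depend on the run only through `#T_{l₆}`. -/
theorem sum_card_marked_le (l : ℕ) :
    D.T0.card + ∑ j ∈ Finset.range l, (r.marked j).card ≤ (r.mesh l).card := by
  induction l with
  | zero => simp [r.mesh_zero]
  | succ l ih =>
    rw [Finset.sum_range_succ]
    have := r.card_add_card_marked_le l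
    omega

theorem U_of_solvable {l : ℕ} (h : D.Solvable P (r.mesh l)) : r.U l = D.sol P (r.mesh l) := by
  cases l <;> simp [U, h]

theorem est_of_solvable {l : ℕ} (h : D.Solvable P (r.mesh l)) : r.est l = D.eta (r.mesh l) := by
  cases l <;> simp [est, h]

/-- The algorithm is eventually solvable and satisfies the quasi-orthogonality. -/
theorem exists_quasiOrthogonalFrom [CompleteSpace H] (hr : r.limitSpace = Set.univ) {ε : ℝ}
    (hε : 0 < ε) (hε' : ε < 1) : ∃ l₃, r.QuasiOrthogonalFrom ε l₃ := by
  obtain ⟨N, γ, hγ, hN⟩ := P.exists_le_infSup r.monotone_X hr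
  obtain ⟨N', hN'⟩ := P.exists_quasiOrthogonal r.monotone_X hr hε hε'
  have hsol : ∀ l, N ≤ l → D.Solvable P (r.mesh l) := fun l hl => by
    have := D.finiteDimensional _ (r.admissible l)
    exact P.solvable_of_le_infSup hγ (hN _ (r.monotone_X hl))
  refine ⟨max N N', fun l hl => ?_⟩
  have h1 := hsol l ((le_max_left _ _).trans hl)
  have h2 := hsol (l + 1) (((le_max_left _ _).trans hl).trans (Nat.le_succ l))
  rw [r.U_of_solvable h1, r.U_of_solvable h2]
  exact hN' _ _ (r.monotone_X ((le_max_right _ _).trans hl)) (r.monotone_X (Nat.le_succ l)) h1 h2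

end AdaptiveRun

end Meshes

/-! ### Estimator reduction, Dörfler optimality and perturbed contraction -/

section Estimator

variable {d : ℕ} {Ω : Set (EuclideanSpace ℝ (Fin d))}
  {𝕜 : Type*} [RCLike 𝕜] {H : Type*} [NormedAddCommGroup H] [InnerProductSpace 𝕜 H]

theorem sq_le_of_abs_sub_le {x y c δ : ℝ} (hδ : 0 < δ) (hx : 0 ≤ x) (h : |x - y| ≤ c) :
    x ^ 2 ≤ (1 + δ) * y ^ 2 + (1 + δ⁻¹) * c ^ 2 := by
  have h1 : x ≤ |y| + c := by
    have := (abs_le.1 h).2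
    have := le_abs_self y
    linarith
  have h2 : x ^ 2 ≤ (|y| + c) ^ 2 := by gcongr
  have h3 : 0 ≤ δ⁻¹ * (δ * |y| - c) ^ 2 := by positivity
  have h4 : δ⁻¹ * (δ * |y| - c) ^ 2 = δ * |y| ^ 2 - 2 * |y| * c + δ⁻¹ * c ^ 2 := by
    field_simp
    ring
  rw [sq_abs] at h4
  have h5 : (|y| + c) ^ 2 = y ^ 2 + 2 * |y| * c + c ^ 2 := by
    rw [← sq_abs y]
    ring
  linarith

namespace Discretization

variable (P : Problem 𝕜 H) (D : Discretization 𝕜 H Ω)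

theorem etaOn_nonneg (T : Triangulation Ω) (A : Finset (Set (EuclideanSpace ℝ (Fin d)))) :
    0 ≤ D.etaOn T A := Real.sqrt_nonneg _

theorem eta_nonneg (T : Triangulation Ω) : 0 ≤ D.eta T := Real.sqrt_nonneg _

theorem etaOn_sq (T : Triangulation Ω) (A : Finset (Set (EuclideanSpace ℝ (Fin d)))) :
    D.etaOn T A ^ 2 = ∑ E ∈ A, D.η T E ^ 2 :=
  Real.sq_sqrt (Finset.sum_nonneg fun _ _ => sq_nonneg _)

theorem etaOn_mono (T : Triangulation Ω) {A B : Finset (Set (EuclideanSpace ℝ (Fin d)))}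
    (h : A ⊆ B) : D.etaOn T A ≤ D.etaOn T B :=
  Real.sqrt_le_sqrt (Finset.sum_le_sum_of_subset_of_nonneg h fun _ _ _ => sq_nonneg _)

theorem eta_sq_eq_inter_add_sdiff (T T' : Triangulation Ω) :
    D.eta T ^ 2 = D.etaOn T (T.inter T') ^ 2 + D.etaOn T (T.sdiff T') ^ 2 := by
  classical
  rw [eta, etaOn_sq, etaOn_sq, etaOn_sq, Triangulation.inter, Triangulation.sdiff,
    Finset.sum_inter_add_sum_sdiff]

theorem inter_comm (T T' : Triangulation Ω) : T.inter T' = T'.inter T := by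
  classical
  rw [Triangulation.inter, Triangulation.inter]
  convert Finset.inter_comm _ _

variable {P D} {Cstb Cred qred Crel' Crel Cmesh Cmark γ θ : ℝ} {T T' That : Triangulation Ω}

theorem DiscreteReliability.exists_refined (hA4 : D.DiscreteReliability P Crel) (hCrel : 0 < Crel)
    (hγ : 0 < γ) (hT : D.Admissible T) (hT' : D.S.Refines T T') (hs : D.Solvable P T)
    (hs' : D.Solvable P T') (hinf : ENNReal.ofReal γ ≤ P.infSup (D.X T')) :
    ∃ R, R ⊆ T.elems ∧ T.sdiff T' ⊆ R ∧ (R.card : ℝ) ≤ Crel * ((T.sdiff T').card : ℝ) ∧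
      ‖D.sol P T' - D.sol P T‖ ≤ Crel * γ⁻¹ * D.etaOn T R := by
  obtain ⟨R, hR, h⟩ := hA4 T T' hT hT'
  obtain ⟨h1, h2, h3⟩ := h hs hs'
  refine ⟨R, hR, h2, h3, h1.trans ?_⟩
  have := P.toReal_infSup_inv_le hγ hinf
  have := D.etaOn_nonneg T R
  gcongr

/-- The constant of the quasi-monotonicity of the squared estimator. -/
def monConst (Cstb Cred Crel γ : ℝ) : ℝ := 2 + (2 * Cstb ^ 2 + Cred ^ 2) * (Crel * γ⁻¹) ^ 2

theorem monConst_pos : 0 < monConst Cstb Cred Crel γ := by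
  rw [monConst]
  positivity

/-- Quasi-monotonicity of the estimator. -/
theorem eta_sq_le_of_refines (hA1 : D.Stability P Cstb) (hA2 : D.Reduction P Cred qred)
    (hA4 : D.DiscreteReliability P Crel) (hqred' : qred < 1) (hCrel : 0 < Crel)
    (hγ : 0 < γ) (hT : D.Admissible T) (hT' : D.S.Refines T T') (hs : D.Solvable P T)
    (hs' : D.Solvable P T') (hinf : ENNReal.ofReal γ ≤ P.infSup (D.X T')) :
    D.eta T' ^ 2 ≤ monConst Cstb Cred Crel γ * D.eta T ^ 2 := by
  obtain ⟨R, hR, -, -, hd⟩ := hA4.exists_refined hCrel hγ hT hT' hs hs' hinf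
  have hd' : ‖D.sol P T' - D.sol P T‖ ≤ Crel * γ⁻¹ * D.eta T :=
    hd.trans (mul_le_mul_of_nonneg_left (D.etaOn_mono T hR) (by positivity))
  have hd2 : ‖D.sol P T' - D.sol P T‖ ^ 2 ≤ (Crel * γ⁻¹) ^ 2 * D.eta T ^ 2 := by
    rw [← mul_pow]
    gcongr
  have h1 := sq_le_of_abs_sub_le one_pos (D.etaOn_nonneg _ _) (hA1 T T' hT hT' hs hs')
  have h2 := hA2 T T' hT hT' hs hs'
  have h3 := D.eta_sq_eq_inter_add_sdiff T' T
  have h4 := D.eta_sq_eq_inter_add_sdiff T T'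
  rw [inter_comm] at h4
  have h5 : 0 ≤ D.etaOn T (T.sdiff T') ^ 2 := sq_nonneg _
  have h6 := mul_le_mul_of_nonneg_left hd2 (by positivity : 0 ≤ 2 * Cstb ^ 2 + Cred ^ 2)
  rw [monConst]
  have h7 : qred * D.etaOn T (T.sdiff T') ^ 2 ≤ 1 * D.etaOn T (T.sdiff T') ^ 2 := by gcongr
  norm_num at h1
  nlinarith

/-- Optimality of the Dörfler criterion. -/
theorem exists_doerfler_optimal (hA1 : D.Stability P Cstb)
    (hA4 : D.DiscreteReliability P Crel) (hCstb : 0 < Cstb) (hCrel : 0 < Crel)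
    (hγ : 0 < γ) (hθ : 0 < θ) (hθ' : θ < thetaOpt Cstb Crel γ) :
    ∃ κ : ℝ, 0 < κ ∧ ∀ T T', D.Admissible T → D.S.Refines T T' → D.Solvable P T →
      D.Solvable P T' → ENNReal.ofReal γ ≤ P.infSup (D.X T') → D.eta T' ^ 2 ≤ κ * D.eta T ^ 2 →
      ∃ R, R ⊆ T.elems ∧ (R.card : ℝ) ≤ Crel * ((T.sdiff T').card : ℝ) ∧
        θ * D.eta T ^ 2 ≤ D.etaOn T R ^ 2 := by
  set G := Cstb ^ 2 * Crel ^ 2 / γ ^ 2 with hG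
  have hG0 : 0 < G := by positivity
  -- The hypothesis `θ < thetaOpt` in usable form. Half of the slack is `ζ`, and the Young parameter
  -- `δ` is chosen so that `θ (1 + (1 + δ) G) = 1 - ζ`.
  have hθG : θ * (1 + G) < 1 := by
    rw [thetaOpt, ← hG] at hθ'
    exact (lt_inv_mul_iff₀' (by positivity)).1 (by simpa using hθ')
  set ζ := (1 - θ * (1 + G)) / 2 with hζ
  have hζ0 : 0 < ζ := by linarith
  set δ := ζ / (θ * G) with hδ
  have hδ0 : 0 < δ := by positivity
  have hδG : θ * (1 + (1 + δ) * G) = 1 - ζ := by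
    have : θ * (δ * G) = ζ := by
      rw [hδ]
      field_simp
    linarith
  refine ⟨ζ / (1 + δ⁻¹), by positivity, fun T T' hT hT' hs hs' hinf hη => ?_⟩
  obtain ⟨R, hR, hRs, hRc, hd⟩ := hA4.exists_refined hCrel hγ hT hT' hs hs' hinf
  refine ⟨R, hR, hRc, ?_⟩
  have h0 := hA1 T T' hT hT' hs hs'
  rw [abs_sub_comm] at h0
  have h1 := sq_le_of_abs_sub_le (inv_pos.2 hδ0) (D.etaOn_nonneg _ _) h0
  rw [inv_inv] at h1
  have h2 : D.etaOn T' (T'.inter T) ^ 2 ≤ D.eta T' ^ 2 := by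
    rw [D.eta_sq_eq_inter_add_sdiff T' T]
    exact le_add_of_nonneg_right (sq_nonneg _)
  have h3 : (1 + δ⁻¹) * D.etaOn T' (T'.inter T) ^ 2 ≤ ζ * D.eta T ^ 2 := by
    calc _ ≤ (1 + δ⁻¹) * (ζ / (1 + δ⁻¹) * D.eta T ^ 2) := by
          gcongr
          exact h2.trans hη
      _ = _ := by field_simp
  have h4 := D.eta_sq_eq_inter_add_sdiff T T'
  rw [inter_comm] at h4
  have h5 : D.etaOn T (T.sdiff T') ^ 2 ≤ D.etaOn T R ^ 2 :=
    pow_le_pow_left₀ (D.etaOn_nonneg _ _) (D.etaOn_mono T hRs) 2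
  have h6 : (Cstb * ‖D.sol P T' - D.sol P T‖) ^ 2 ≤ G * D.etaOn T R ^ 2 := by
    calc _ ≤ (Cstb * (Crel * γ⁻¹ * D.etaOn T R)) ^ 2 := by gcongr
      _ = _ := by
        rw [hG]
        field_simp
  have h7 := mul_le_mul_of_nonneg_left h6 (by linarith : 0 ≤ 1 + δ)
  have h8 : (1 - ζ) * D.eta T ^ 2 ≤ (1 + (1 + δ) * G) * D.etaOn T R ^ 2 := by linarith
  have h9 := mul_le_mul_of_nonneg_left h8 hθ.le
  have h10 : 0 < 1 - ζ := by
    rw [← hδG]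
    positivity
  rw [← mul_assoc θ (1 + (1 + δ) * G), hδG] at h9
  exact le_of_mul_le_mul_left (by linarith) h10

/-- Estimator reduction for a step with Dörfler marking. -/
theorem exists_estimator_reduction (hA1 : D.Stability P Cstb) (hA2 : D.Reduction P Cred qred)
    (hCstb : 0 < Cstb) (hqred : 0 < qred) (hqred' : qred < 1) (hθ : 0 < θ) (hθ' : θ < 1) :
    ∃ q C : ℝ, 0 < q ∧ q < 1 ∧ 0 < C ∧ ∀ T T' M, D.Admissible T → D.S.Refines T T' →
      D.Solvable P T → D.Solvable P T' → M ⊆ T.sdiff T' → θ * D.eta T ^ 2 ≤ D.etaOn T M ^ 2 →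
      D.eta T' ^ 2 ≤ q * D.eta T ^ 2 + C * ‖D.sol P T' - D.sol P T‖ ^ 2 := by
  -- Axiom (A2) and Dörfler marking alone give the factor `t < 1`; `δ` is the Young parameter that
  -- raises it to `(1 + t) / 2`.
  set t := 1 - (1 - qred) * θ with ht
  have ht0 : 0 < t := by nlinarith
  have ht1 : t < 1 := by nlinarith
  set δ := (1 - t) / (2 * t) with hδ
  have hδ0 : 0 < δ := div_pos (by linarith) (by linarith)
  have hδt : (1 + δ) * t = (1 + t) / 2 := by
    rw [hδ]
    field_simp
    ring
  refine ⟨(1 + t) / 2, (1 + δ⁻¹) * Cstb ^ 2 + Cred ^ 2, by linarith, by linarith, by positivity,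
    fun T T' M hT hT' hs hs' hM hdo => ?_⟩
  have h1 := sq_le_of_abs_sub_le hδ0 (D.etaOn_nonneg _ _) (hA1 T T' hT hT' hs hs')
  have h2 := hA2 T T' hT hT' hs hs'
  have h3 := D.eta_sq_eq_inter_add_sdiff T' T
  have h4 := D.eta_sq_eq_inter_add_sdiff T T'
  rw [inter_comm] at h4
  have h5 : D.etaOn T M ^ 2 ≤ D.etaOn T (T.sdiff T') ^ 2 :=
    pow_le_pow_left₀ (D.etaOn_nonneg _ _) (D.etaOn_mono T hM) 2
  set S := D.etaOn T (T.sdiff T') ^ 2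
  have hS : 0 ≤ S := sq_nonneg _
  have h6 : (1 + δ) * D.etaOn T (T'.inter T) ^ 2 + qred * S ≤ (1 + t) / 2 * D.eta T ^ 2 := by
    rw [← hδt]
    have h7 : (1 - qred) * (θ * D.eta T ^ 2) ≤ (1 - qred) * S :=
      mul_le_mul_of_nonneg_left (hdo.trans h5) (by linarith)
    have h8 : D.etaOn T (T'.inter T) ^ 2 + qred * S ≤ t * D.eta T ^ 2 := by
      rw [ht]
      linarith
    have h9 := mul_le_mul_of_nonneg_left h8 (by linarith : 0 ≤ 1 + δ)
    nlinarith [mul_nonneg hδ0.le (mul_nonneg hqred.le hS)]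
  rw [mul_pow] at h1
  linarith

end Discretization

/-- The perturbed contraction argument: reduction of `h` up to `d`, quasi-orthogonality of `E`
with a sufficiently small parameter, and `E ≲ h` yield linear convergence of `h`. -/
theorem exists_linear_convergence {q C C₂ : ℝ} (hq : 0 < q) (hq' : q < 1) (hC : 0 < C)
    (hC₂ : 0 < C₂) :
    ∃ ε : ℝ, 0 < ε ∧ ε < 1 ∧ ∃ Clin ρ : ℝ, 0 < Clin ∧ 0 < ρ ∧ ρ < 1 ∧
      ∀ (E h δ : ℕ → ℝ) (l₀ : ℕ), (∀ l, 0 ≤ E l) → (∀ l, 0 ≤ h l) →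
        (∀ l ≥ l₀, E (l + 1) + δ l ≤ 1 / (1 - ε) * E l) →
        (∀ l ≥ l₀, h (l + 1) ≤ q * h l + C * δ l) → (∀ l ≥ l₀, E l ≤ C₂ * h l) →
        ∀ l ≥ l₀, ∀ k, h (l + k) ≤ Clin * ρ ^ k * h l := by
  -- In the contraction of `C E + h` the `δ` terms cancel. Reliability moves `C μ E` onto `h`,
  -- costing `(1 - q) / 2`, and `ε` below satisfies `1 / (1 - ε) = 1 + μ / 2`, so a net gain of `μ /
  -- 2` remains.
  set μ := (1 - q) / (2 * C * C₂) with hμ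
  have hμ0 : 0 < μ := div_pos (by linarith) (by positivity)
  have hμC : C * (μ * C₂) = (1 - q) / 2 := by
    rw [hμ]
    field_simp
  set ρ := max (1 - μ / 2) ((1 + q) / 2) with hρ
  have hρ1 : ρ < 1 := max_lt (by linarith) (by linarith)
  have hρ0 : 0 < ρ := lt_max_of_lt_right (by linarith)
  refine ⟨μ / 2 / (1 + μ / 2), by positivity, (div_lt_one (by positivity)).2 (by linarith),
    C * C₂ + 1, ρ, by positivity, hρ0, hρ1, fun E h δ l₀ hE hh hqo hred hrel => ?_⟩
  have hε : 1 / (1 - μ / 2 / (1 + μ / 2)) = 1 + μ / 2 := by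
    have : 1 - μ / 2 / (1 + μ / 2) = (1 + μ / 2)⁻¹ := by
      field_simp
      ring
    rw [this, one_div, inv_inv]
  rw [hε] at hqo
  have hstep : ∀ l ≥ l₀, C * E (l + 1) + h (l + 1) ≤ ρ * (C * E l + h l) := fun l hl => by
    have h1 := mul_le_mul_of_nonneg_left (hqo l hl) hC.le
    have h2 := hred l hl
    have h3 := mul_le_mul_of_nonneg_left (hrel l hl) (mul_pos hC hμ0).le
    have h4 : (1 - μ / 2) * (C * E l) ≤ ρ * (C * E l) :=
      mul_le_mul_of_nonneg_right (le_max_left _ _) (mul_nonneg hC.le (hE l))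
    have h5 : (1 + q) / 2 * h l ≤ ρ * h l := mul_le_mul_of_nonneg_right (le_max_right _ _) (hh l)
    have h6 : C * μ * (C₂ * h l) = (1 - q) / 2 * h l := by
      rw [← hμC]
      ring
    nlinarith
  intro l hl k
  have hk : C * E (l + k) + h (l + k) ≤ ρ ^ k * (C * E l + h l) := by
    induction k with
    | zero => simp
    | succ k ih =>
      calc _ ≤ ρ * (C * E (l + k) + h (l + k)) := hstep (l + k) (by omega)
        _ ≤ ρ * (ρ ^ k * (C * E l + h l)) := by gcongr
        _ = _ := by ring
  have h1 : C * E l ≤ C * (C₂ * h l) := mul_le_mul_of_nonneg_left (hrel l hl) hC.le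
  calc h (l + k) ≤ C * E (l + k) + h (l + k) := le_add_of_nonneg_left (mul_nonneg hC.le (hE _))
    _ ≤ _ := hk
    _ ≤ ρ ^ k * (C * (C₂ * h l) + h l) := by gcongr
    _ = _ := by ring

end Estimator

/-! ### Linear convergence and optimal rates for runs -/

section Rates

variable {d : ℕ} {Ω : Set (EuclideanSpace ℝ (Fin d))}
  {𝕜 : Type*} [RCLike 𝕜] {H : Type*} [NormedAddCommGroup H] [InnerProductSpace 𝕜 H]
  {P : Problem 𝕜 H} {D : Discretization 𝕜 H Ω}
  {Cstb Cred qred Crel' Crel Cmesh Cmark γ θ : ℝ} {That : Triangulation Ω}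

theorem thetaOpt_le_one : thetaOpt Cstb Crel γ ≤ 1 := by
  rw [thetaOpt]
  exact inv_le_one_of_one_le₀ (le_add_of_nonneg_right (by positivity))

/-- Continuity of `thetaOpt` at `γ`: the strict inequality leaves room for the loss in
`exists_infSup_transfer`. -/
theorem exists_thetaOpt_lt (hγ : 0 < γ) (hθ : θ < thetaOpt Cstb Crel γ) :
    ∃ γ' : ℝ, 0 < γ' ∧ γ' < γ ∧ θ < thetaOpt Cstb Crel γ' := by
  have hc : ContinuousAt (thetaOpt Cstb Crel) γ := by
    unfold thetaOpt
    have h1 : γ ^ 2 ≠ 0 := by positivity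
    have h2 : 1 + Cstb ^ 2 * Crel ^ 2 / γ ^ 2 ≠ 0 := by positivity
    fun_prop (disch := assumption)
  have h1 : ∀ᶠ x in 𝓝[<] γ, θ < thetaOpt Cstb Crel x ∧ 0 < x :=
    ((hc.eventually_const_lt hθ).and (eventually_gt_nhds hγ)).filter_mono nhdsWithin_le_nhds
  obtain ⟨x, ⟨hx, hx0⟩, hxγ⟩ := (h1.and self_mem_nhdsWithin).exists
  exact ⟨x, hx0, hxγ, hx⟩

theorem Discretization.solvable_of_refines [CompleteSpace H] (hγ : 0 < γ)
    (hThat : D.Admissible That)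
    (hinf : ∀ T, D.S.Refines That T → ENNReal.ofReal γ ≤ P.infSup (D.X T))
    {T : Triangulation Ω} (hT : D.S.Refines That T) : D.Solvable P T := by
  have := D.finiteDimensional _ (hThat.trans hT)
  exact P.solvable_of_le_infSup hγ (hinf T hT)

/-- Linear convergence of the adaptive algorithm. -/
theorem AdaptiveRun.exists_linear_convergence [CompleteSpace H]
    (hCstb : 0 < Cstb) (hqred : 0 < qred) (hqred' : qred < 1)
    (hA1 : D.Stability P Cstb) (hA2 : D.Reduction P Cred qred)
    (hA3 : D.Reliability P Crel') (hγ : 0 < γ) (hThat : D.Admissible That)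
    (hinf : ∀ T, D.S.Refines That T → ENNReal.ofReal γ ≤ P.infSup (D.X T))
    (hθ : 0 < θ) (hθ' : θ < 1) :
    ∃ ε : ℝ, 0 < ε ∧ ε < 1 ∧ ∃ Clin ρ : ℝ, 0 < Clin ∧ 0 < ρ ∧ ρ < 1 ∧
      ∀ (r : AdaptiveRun P D θ Cmark) (l₆ : ℕ), r.QuasiOrthogonalFrom ε l₆ →
        (∀ l ≥ l₆, D.S.Refines That (r.mesh l)) →
        ∀ l ≥ l₆, ∀ k, D.eta (r.mesh (l + k)) ^ 2 ≤ Clin * ρ ^ k * D.eta (r.mesh l) ^ 2 := by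
  obtain ⟨α, hα, hell⟩ := P.elliptic
  obtain ⟨q, C, hq, hq', hC, hred⟩ :=
    Discretization.exists_estimator_reduction hA1 hA2 hCstb hqred hqred' hθ hθ'
  obtain ⟨ε, hε, hε', Clin, ρ, hClin, hρ, hρ', hlin⟩ :=
    AFEM.exists_linear_convergence (q := q) (C := C / α) (C₂ := ‖P.a‖ * Crel' ^ 2 + 1) hq hq'
      (by positivity) (by positivity)
  refine ⟨ε, hε, hε', Clin, ρ, hClin, hρ, hρ', fun r l₆ hqo href => ?_⟩
  have hsol : ∀ l ≥ l₆, D.Solvable P (r.mesh l) := fun l hl =>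
    Discretization.solvable_of_refines hγ hThat hinf (href l hl)
  refine hlin (fun l => P.energySq (P.u - r.U l)) (fun l => D.eta (r.mesh l) ^ 2)
    (fun l => P.energySq (r.U (l + 1) - r.U l)) l₆ (fun l => le_trans (by positivity) (hell _))
    (fun l => sq_nonneg _) hqo (fun l hl => ?_) (fun l hl => ?_)
  · have h1 := hsol l hl
    have h2 := hsol (l + 1) (Nat.le_succ_of_le hl)
    refine (hred _ _ _ (r.admissible l) (r.refines_succ l) h1 h2 (r.marked_subset_sdiff l)
      (r.doerfler l h1)).trans (add_le_add_right ?_ _)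
    rw [r.U_of_solvable h1, r.U_of_solvable h2, div_mul_eq_mul_div, mul_div_assoc]
    refine mul_le_mul_of_nonneg_left ?_ hC.le
    rw [le_div_iff₀ hα, mul_comm]
    exact hell _
  · have h1 := hsol l hl
    rw [r.U_of_solvable h1]
    refine (P.energySq_le _).trans ?_
    have h2 := hA3 _ (r.admissible l) h1
    calc ‖P.a‖ * ‖P.u - D.sol P (r.mesh l)‖ ^ 2
        ≤ ‖P.a‖ * (Crel' * D.eta (r.mesh l)) ^ 2 := by gcongr
      _ = ‖P.a‖ * Crel' ^ 2 * D.eta (r.mesh l) ^ 2 := by ring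
      _ ≤ _ := by
        gcongr
        linarith

/-- The number of marked elements is controlled by the estimator if `u` is in the approximation
class. -/
theorem AdaptiveRun.exists_card_marked_le [CompleteSpace H]
    (hCstb : 0 < Cstb) (hqred' : qred < 1) (hCrel : 0 < Crel) (hCmark : 1 ≤ Cmark)
    (hA1 : D.Stability P Cstb) (hA2 : D.Reduction P Cred qred)
    (hA4 : D.DiscreteReliability P Crel) (hoverlay : D.Overlay)
    (hγ : 0 < γ) (hThat : D.Admissible That)
    (hinf : ∀ T, D.S.Refines That T → ENNReal.ofReal γ ≤ P.infSup (D.X T))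
    (hθ : 0 < θ) (hθ' : θ < thetaOpt Cstb Crel γ) {s : ℝ} (hs : 0 < s)
    (hfin : D.approxNorm P s < ⊤) :
    ∃ C₁ : ℝ, 0 < C₁ ∧ ∀ (r : AdaptiveRun P D θ Cmark) (l : ℕ), D.S.Refines That (r.mesh l) →
      0 < D.eta (r.mesh l) →
      ((r.marked l).card : ℝ) ≤ C₁ * (D.eta (r.mesh l) ^ 2) ^ (-(1 / (2 * s))) := by
  obtain ⟨κ, hκ, hopt⟩ := Discretization.exists_doerfler_optimal hA1 hA4 hCstb hCrel hγ hθ hθ'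
  have hsol : ∀ T, D.S.Refines That T → D.Solvable P T := fun T hT =>
    Discretization.solvable_of_refines hγ hThat hinf hT
  set Cm := Discretization.monConst Cstb Cred Crel γ
  have hCm : 0 < Cm := Discretization.monConst_pos
  set t := 1 / (2 * s) with ht
  have ht0 : 0 < t := by positivity
  set hmax := Cm * D.eta That ^ 2 + 1
  have hmax0 : 0 < hmax := by positivity
  -- With `N₀` extra elements allowed, `That` itself competes, so the infimum is over a nonempty set
  -- and the default `sInf ∅ = 0` plays no role.
  set N₀ := That.card - D.T0.card
  have hN₀ : That.card ≤ D.T0.card + N₀ := by omega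
  set A := (D.approxNorm P s).toReal + 1
  have hA0 : 0 < A := add_pos_of_nonneg_of_pos ENNReal.toReal_nonneg one_pos
  have hA : ∀ N : ℕ, ((N : ℝ) + 1) ^ s * sInf (D.eta '' D.meshesUpTo P D.T0 N) ≤ A := fun N => by
    have h1 : ENNReal.ofReal (((N : ℝ) + 1) ^ s * sInf (D.eta '' D.meshesUpTo P D.T0 N)) ≤
        D.approxNorm P s := le_iSup (fun N : ℕ => ENNReal.ofReal (((N : ℝ) + 1) ^ s *
          sInf (D.eta '' D.meshesUpTo P D.T0 N))) N
    have h2 := (ENNReal.ofReal_le_iff_le_toReal hfin.ne).1 h1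
    exact h2.trans (le_add_of_nonneg_right zero_le_one)
  -- Since `Cm (2 κ')² = κ`, quasi-monotonicity from `Te` to the overlay yields the reduction by
  -- `κ`. The factor `2` leaves room to pick a mesh strictly above the infimum.
  set κ' := Real.sqrt (κ / Cm) / 2 with hκ'
  have hκ'0 : 0 < κ' := by positivity
  set B := (A / κ') ^ (1 / s)
  have hB : 0 < B := by positivity
  refine ⟨Cmark * Crel * (N₀ * hmax ^ t + B), by positivity, fun r l href hη => ?_⟩
  set T := r.mesh l
  set η := D.eta T
  have hη2 : 0 < η ^ 2 := by positivity
  have hpow : (η ^ 2) ^ (-t) = η ^ (-(1 / s)) := by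
    rw [← Real.rpow_natCast η 2, ← Real.rpow_mul hη.le, ht]
    congr 1
    field_simp
    norm_num
  have hxpow : (A / (κ' * η)) ^ (1 / s) = B * (η ^ 2) ^ (-t) := by
    rw [hpow, ← div_div, Real.div_rpow (by positivity) hη.le, Real.rpow_neg hη.le, div_eq_mul_inv]
  set x := (A / (κ' * η)) ^ (1 / s) with hx
  have hx0 : 0 < x := by positivity
  have hηmax : η ^ 2 ≤ hmax := by
    refine (Discretization.eta_sq_le_of_refines hA1 hA2 hA4 hqred' hCrel hγ hThat href
      (hsol _ Relation.ReflTransGen.refl) (hsol _ href) (hinf _ href)).trans ?_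
    exact le_add_of_nonneg_right zero_le_one
  -- Quasi-monotonicity from `That` bounds the estimator, so constants such as `N₀` can be absorbed
  -- into the negative power of `η`.
  have hone : 1 ≤ hmax ^ t * (η ^ 2) ^ (-t) := by
    rw [Real.rpow_neg hη2.le, ← div_eq_mul_inv, one_le_div (by positivity)]
    gcongr
  set N := N₀ + ⌊x⌋₊
  have hNx : x ≤ (N : ℝ) + 1 := by
    have h1 := Nat.lt_floor_add_one x
    have h2 : ((N₀ + ⌊x⌋₊ : ℕ) : ℝ) = N₀ + ⌊x⌋₊ := by push_cast; rfl
    have h3 : (0 : ℝ) ≤ N₀ := Nat.cast_nonneg _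
    change x ≤ ((N₀ + ⌊x⌋₊ : ℕ) : ℝ) + 1
    linarith
  have hNle : (N : ℝ) ≤ (N₀ * hmax ^ t + B) * (η ^ 2) ^ (-t) := by
    have h1 : ((N₀ + ⌊x⌋₊ : ℕ) : ℝ) = N₀ + ⌊x⌋₊ := by push_cast; rfl
    have h2 := Nat.floor_le hx0.le
    have h3 : (N₀ : ℝ) * 1 ≤ N₀ * (hmax ^ t * (η ^ 2) ^ (-t)) := by gcongr
    change ((N₀ + ⌊x⌋₊ : ℕ) : ℝ) ≤ _
    rw [h1]
    linarith
  have hmin : sInf (D.eta '' D.meshesUpTo P D.T0 N) < 2 * κ' * η := by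
    have h1 : A / (κ' * η) ≤ ((N : ℝ) + 1) ^ s := by
      calc A / (κ' * η) = x ^ s := by
            rw [hx, ← Real.rpow_mul (by positivity), one_div_mul_cancel hs.ne', Real.rpow_one]
        _ ≤ _ := by gcongr
    have hp : 0 < ((N : ℝ) + 1) ^ s := by positivity
    have h2 : sInf (D.eta '' D.meshesUpTo P D.T0 N) ≤ κ' * η := by
      by_contra! hlt
      have h3 := mul_lt_mul_of_pos_left hlt hp
      have h4 := (div_le_iff₀ (by positivity)).1 h1
      linarith [hA N]
    have h5 : 0 < κ' * η := by positivity
    linarith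
  have hne : (D.eta '' D.meshesUpTo P D.T0 N).Nonempty :=
    ⟨_, That, ⟨hThat, hN₀.trans (by omega), hsol _ Relation.ReflTransGen.refl⟩, rfl⟩
  obtain ⟨_, ⟨Te, ⟨hTe, hTec, hTes⟩, rfl⟩, hTeη⟩ := exists_lt_of_csInf_lt hne hmin
  obtain ⟨T', hT', hTe', hcard⟩ := hoverlay D.T0 T Te Relation.ReflTransGen.refl (r.admissible l) hTe
  have hThatT' : D.S.Refines That T' := Relation.ReflTransGen.trans href hT'
  have hηT' : D.eta T' ^ 2 ≤ κ * η ^ 2 := by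
    have h1 := Discretization.eta_sq_le_of_refines hA1 hA2 hA4 hqred' hCrel hγ hTe hTe' hTes
      (hsol _ hThatT') (hinf _ hThatT')
    have h2 : D.eta Te ^ 2 ≤ (2 * κ' * η) ^ 2 :=
      pow_le_pow_left₀ (D.eta_nonneg _) hTeη.le 2
    calc D.eta T' ^ 2 ≤ Cm * (2 * κ' * η) ^ 2 := h1.trans (by gcongr)
      _ = Cm * (Real.sqrt (κ / Cm) ^ 2 * η ^ 2) := by rw [hκ']; ring
      _ = _ := by
        rw [Real.sq_sqrt (by positivity)]
        field_simp
  obtain ⟨R, hR, hRc, hRη⟩ := hopt T T' (r.admissible l) hT' (hsol _ href) (hsol _ hThatT')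
    (hinf _ hThatT') hηT'
  have hm := r.marked_minimal l (hsol _ href) R hR hRη
  -- Refined elements are at most `#T' - #T`, and the overlay estimate bounds this by `#Te - #T0 ≤
  -- N`.
  have hsd : ((T.sdiff T').card : ℝ) ≤ N := by
    have := Discretization.Admissible.card_add_card_sdiff_le (T := T) (r.admissible l) hT'
    have h : (T.sdiff T').card ≤ N := by omega
    exact_mod_cast h
  calc ((r.marked l).card : ℝ) ≤ Cmark * (R.card : ℝ) := hm
    _ ≤ Cmark * (Crel * ((N₀ * hmax ^ t + B) * (η ^ 2) ^ (-t))) := by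
      gcongr
      exact hRc.trans (by gcongr; exact hsd.trans hNle)
    _ = _ := by ring

/-- Geometric growth of `h_j^{-t}` along a linearly convergent sequence. -/
theorem sum_rpow_neg_le {h : ℕ → ℝ} {Clin ρ t : ℝ} (hClin : 0 < Clin) (hρ : 0 < ρ) (hρ' : ρ < 1)
    (ht : 0 < t) {l₀ : ℕ} (hh : ∀ l ≥ l₀, ∀ k, h (l + k) ≤ Clin * ρ ^ k * h l) {l : ℕ}
    (hpos : 0 < h l) :
    ∑ j ∈ Finset.Ico l₀ l, h j ^ (-t) ≤ Clin ^ t * (1 - ρ ^ t)⁻¹ * h l ^ (-t) := by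
  have hσ0 : 0 < ρ ^ t := by positivity
  have hσ1 : ρ ^ t < 1 := Real.rpow_lt_one hρ.le hρ' ht
  have h1 : ∀ j ∈ Finset.Ico l₀ l, h j ^ (-t) ≤ Clin ^ t * h l ^ (-t) * (ρ ^ t) ^ (l - j) := by
    intro j hj
    obtain ⟨hj, hjl⟩ := Finset.mem_Ico.1 hj
    have h2 := hh j hj (l - j)
    rw [Nat.add_sub_cancel' hjl.le] at h2
    have hc : 0 < Clin * ρ ^ (l - j) := by positivity
    have hj0 : 0 < h j := pos_of_mul_pos_right (hpos.trans_le h2) hc.le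
    have h3 : h l ^ t ≤ (Clin * ρ ^ (l - j) * h j) ^ t := by gcongr
    rw [Real.mul_rpow hc.le hj0.le, Real.mul_rpow hClin.le (by positivity), ← Real.rpow_natCast ρ,
      ← Real.rpow_mul hρ.le, mul_comm _ t, Real.rpow_mul hρ.le, Real.rpow_natCast] at h3
    rw [Real.rpow_neg hj0.le, Real.rpow_neg hpos.le]
    have hl' : 0 < h l ^ t := by positivity
    have hj' : 0 < h j ^ t := by positivity
    rw [inv_le_iff_one_le_mul₀ hj']
    calc (1 : ℝ) = h l ^ t * (h l ^ t)⁻¹ := (mul_inv_cancel₀ hl'.ne').symm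
      _ ≤ (Clin ^ t * (ρ ^ t) ^ (l - j) * h j ^ t) * (h l ^ t)⁻¹ := by gcongr
      _ = _ := by ring
  refine (Finset.sum_le_sum h1).trans ?_
  rw [← Finset.mul_sum]
  have h4 : ∑ j ∈ Finset.Ico l₀ l, (ρ ^ t) ^ (l - j) ≤ (1 - ρ ^ t)⁻¹ := by
    have h5 : ∑ j ∈ Finset.Ico l₀ l, (ρ ^ t) ^ (l - j) ≤ ∑ i ∈ Finset.range (l + 1), (ρ ^ t) ^ i := by
      rw [← Finset.sum_range_reflect]
      refine (Finset.sum_le_sum_of_subset_of_nonneg (t := Finset.range (l + 1)) (fun j hj => ?_)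
        (fun _ _ _ => by positivity)).trans (le_of_eq (Finset.sum_congr rfl fun j _ => ?_))
      · have := (Finset.mem_Ico.1 hj).2
        exact Finset.mem_range.2 (by omega)
      · congr 1
    refine h5.trans ?_
    rw [← tsum_geometric_of_lt_one hσ0.le hσ1]
    exact (summable_geometric_of_lt_one hσ0.le hσ1).sum_le_tsum _ (fun _ _ => by positivity)
  have h6 : 0 < h l ^ (-t) := by positivity
  calc _ ≤ Clin ^ t * h l ^ (-t) * (1 - ρ ^ t)⁻¹ := by gcongr
    _ = _ := by ring

/-- An algebraic rate of the algorithm implies membership in the approximation class. -/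
theorem AdaptiveRun.approxNorm_lt_top {Cson : ℕ} (hsons : D.SonBounds Cson) (hθ : 0 < θ)
    (r : AdaptiveRun P D θ Cmark) {l₆ : ℕ} (hsol : ∀ l ≥ l₆, D.Solvable P (r.mesh l)) {s C : ℝ}
    (hs : 0 < s) (hrate : r.RateFrom s C l₆) : D.approxNorm P s < ⊤ := by
  set f : ℕ → ℝ := fun N => ((N : ℝ) + 1) ^ s * sInf (D.eta '' D.meshesUpTo P D.T0 N) with hf
  set Λ : ℝ := (Cson + 1) * (D.T0.card + 1) with hΛ
  have hΛ0 : 0 < Λ := by positivity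
  have hle : ∀ N : ℕ, ∀ T ∈ D.meshesUpTo P D.T0 N,
      sInf (D.eta '' D.meshesUpTo P D.T0 N) ≤ D.eta T := fun N T hT =>
    csInf_le ⟨0, by rintro _ ⟨T, -, rfl⟩; exact D.eta_nonneg T⟩ ⟨T, hT, rfl⟩
  have hlarge : ∀ N : ℕ, (r.mesh l₆).card ≤ D.T0.card + N → f N ≤ Λ ^ s * |C| := by
    intro N hN
    -- The least such `l` is the last mesh within the budget `N`; one step multiplies the
    -- cardinality by at most `Cson + 1`, so `N + 1` is comparable to `#T_l - #T_0 + 1`.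
    by_cases hex : ∃ l, l₆ ≤ l ∧ D.T0.card + N < (r.mesh (l + 1)).card
    · classical
      have hfind := Nat.find_spec hex
      set l := Nat.find hex with hl
      have hlc : (r.mesh l).card ≤ D.T0.card + N := by
        by_cases h0 : l = l₆
        · rw [h0]
          exact hN
        · have hlt : l - 1 < l := by omega
          have := Nat.find_min hex (hl ▸ hlt)
          push Not at this
          have h1 := this (by omega)
          rwa [Nat.sub_add_cancel (by omega)] at h1
      have h1 := hrate l hfind.1
      rw [r.est_of_solvable (hsol l hfind.1)] at h1
      have h0c : D.T0.card ≤ (r.mesh l).card :=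
        Discretization.Admissible.card_le Relation.ReflTransGen.refl (r.admissible l)
      have h0c' : (D.T0.card : ℝ) ≤ (r.mesh l).card := by exact_mod_cast h0c
      set c : ℝ := ((r.mesh l).card : ℝ) - D.T0.card + 1 with hc
      have hc1 : 1 ≤ c := by linarith
      have hNc : (N : ℝ) + 1 ≤ Λ * c := by
        have h2 := hfind.2
        have h3 := hsons.card_refine_le (r.admissible l) (r.marked_subset l)
        rw [← r.mesh_succ] at h3
        have h4 : D.T0.card + N + 1 ≤ (Cson + 1) * (r.mesh l).card := by omega
        have h5 : (D.T0.card : ℝ) + N + 1 ≤ (Cson + 1) * (r.mesh l).card := by exact_mod_cast h4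
        have h6 : ((r.mesh l).card : ℝ) = c - 1 + D.T0.card := by rw [hc]; ring
        have h7 : (0 : ℝ) ≤ D.T0.card := Nat.cast_nonneg _
        have h8 : c - 1 + D.T0.card ≤ (D.T0.card + 1) * c := by nlinarith
        have h9 : (Cson + 1 : ℝ) * (c - 1 + D.T0.card) ≤ (Cson + 1) * ((D.T0.card + 1) * c) := by
          gcongr
        rw [h6] at h5
        rw [hΛ]
        linarith
      have hc0 : 0 < c := by linarith
      have h10 : c ^ s * D.eta (r.mesh l) ≤ C := by
        have h11 := mul_le_mul_of_nonneg_left h1 (Real.rpow_nonneg hc0.le s)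
        rw [Real.rpow_neg hc0.le, mul_left_comm, mul_inv_cancel₀ (by positivity), mul_one] at h11
        exact h11
      have hη0 := D.eta_nonneg (r.mesh l)
      calc f N ≤ ((N : ℝ) + 1) ^ s * D.eta (r.mesh l) := by
            simp only [hf]
            gcongr
            exact hle N _ ⟨r.admissible l, hlc, hsol l hfind.1⟩
        _ ≤ (Λ * c) ^ s * D.eta (r.mesh l) := by gcongr
        _ = Λ ^ s * (c ^ s * D.eta (r.mesh l)) := by
          rw [Real.mul_rpow hΛ0.le hc0.le, mul_assoc]
        _ ≤ Λ ^ s * |C| := by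
          gcongr
          exact h10.trans (le_abs_self C)
    -- Bounded cardinalities force an empty marked set at some index, and the Dörfler criterion then
    -- gives a vanishing estimator.
    · push Not at hex
      have hcard : ∀ l ≥ l₆, (r.mesh l).card ≤ D.T0.card + N := fun l hl =>
        ((r.admissible l).card_le (r.refines_succ l)).trans (hex l hl)
      obtain ⟨l, hl, hm⟩ : ∃ l, l₆ ≤ l ∧ r.marked l = ∅ := by
        by_contra! hcon
        have hgrow : ∀ k, k ≤ (r.mesh (l₆ + k)).card := by
          intro k
          induction k with
          | zero => exact Nat.zero_le _
          | succ k ih =>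
            have h1 := r.card_add_card_marked_le (l₆ + k)
            have h2 := (hcon (l₆ + k) (Nat.le_add_right _ _)).card_pos
            rw [← add_assoc]
            omega
        have h1 := hgrow (D.T0.card + N + 1)
        have h2 := hcard (l₆ + (D.T0.card + N + 1)) (Nat.le_add_right _ _)
        omega
      have h1 := r.doerfler l (hsol l hl)
      rw [hm, D.etaOn_sq, Finset.sum_empty] at h1
      have h2 : D.eta (r.mesh l) ^ 2 ≤ 0 := nonpos_of_mul_nonpos_right h1 hθ
      have h3 : D.eta (r.mesh l) = 0 := by
        have := le_antisymm h2 (sq_nonneg _)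
        simpa using this
      have h4 := hle N _ ⟨r.admissible l, hcard l hl, hsol l hl⟩
      rw [h3] at h4
      calc f N ≤ 0 := mul_nonpos_of_nonneg_of_nonpos (by positivity) h4
        _ ≤ _ := by positivity
  -- The finitely many small `N` are covered by the sum of all their values.
  have hall : ∀ N : ℕ, f N ≤ Λ ^ s * |C| + ∑ j ∈ Finset.range (r.mesh l₆).card, |f j| := by
    intro N
    have hsum : 0 ≤ ∑ j ∈ Finset.range (r.mesh l₆).card, |f j| :=
      Finset.sum_nonneg fun _ _ => abs_nonneg _
    by_cases hN : N < (r.mesh l₆).card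
    · have h1 := Finset.single_le_sum (f := fun j => |f j|) (fun _ _ => abs_nonneg _)
        (Finset.mem_range.2 hN)
      have h2 : 0 ≤ Λ ^ s * |C| := by positivity
      have h3 := le_abs_self (f N)
      linarith
    · have := hlarge N (by omega)
      linarith
  exact lt_of_le_of_lt (iSup_le fun N => ENNReal.ofReal_le_ofReal (hall N)) ENNReal.ofReal_lt_top

/-- Optimal rates for meshes above a fixed mesh with a uniform inf-sup bound. -/
theorem exists_optimal_rates [CompleteSpace H] {Cson : ℕ}
    (hCstb : 0 < Cstb) (hqred : 0 < qred) (hqred' : qred < 1)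
    (hCrel : 0 < Crel) (hCmesh : 1 ≤ Cmesh) (hCmark : 1 ≤ Cmark)
    (hA1 : D.Stability P Cstb) (hA2 : D.Reduction P Cred qred)
    (hA3 : D.Reliability P Crel') (hA4 : D.DiscreteReliability P Crel)
    (hsons : D.SonBounds Cson) (hoverlay : D.Overlay)
    (hγ : 0 < γ) (hThat : D.Admissible That)
    (hinf : ∀ T, D.S.Refines That T → ENNReal.ofReal γ ≤ P.infSup (D.X T))
    (hθ : 0 < θ) (hθ' : θ < thetaOpt Cstb Crel γ) :
    ∃ ε : ℝ, 0 < ε ∧ ε < 1 ∧ ∀ s : ℝ, 0 < s → ∀ n : ℕ, ∃ Copt : ℝ, 0 < Copt ∧ ∀ C ≥ Copt,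
      ∀ r : AdaptiveRun P D θ Cmark, r.MeshClosure Cmesh → ∀ l₆ : ℕ,
        r.QuasiOrthogonalFrom ε l₆ → (∀ l ≥ l₆, D.S.Refines That (r.mesh l)) →
        (r.mesh l₆).card = n → (D.approxNorm P s < ⊤ ↔ r.RateFrom s C l₆) := by
  obtain ⟨ε, hε, hε', Clin, ρ, hClin, hρ, hρ', hlin⟩ :=
    AdaptiveRun.exists_linear_convergence (Cmark := Cmark) hCstb hqred hqred' hA1 hA2 hA3 hγ hThat
      hinf hθ (hθ'.trans_le thetaOpt_le_one)
  refine ⟨ε, hε, hε', fun s hs n => ?_⟩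
  have hsol : ∀ T, D.S.Refines That T → D.Solvable P T := fun T hT =>
    Discretization.solvable_of_refines hγ hThat hinf hT
  -- The approximation norm does not involve the run, so `Copt` may depend on this case. If it is
  -- infinite, no `C` admits the rate and `Copt = 1` serves.
  by_cases hfin : D.approxNorm P s < ⊤
  swap
  · refine ⟨1, one_pos, fun C _ r _ l₆ _ href _ => ⟨fun h => absurd h hfin, fun hrate => ?_⟩⟩
    exact r.approxNorm_lt_top hsons hθ (fun l hl => hsol _ (href l hl)) hs hrate
  obtain ⟨C₁, hC₁, hmark⟩ := AdaptiveRun.exists_card_marked_le hCstb hqred' hCrel hCmark hA1 hA2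
    hA4 hoverlay hγ hThat hinf hθ hθ' hs hfin
  set t := 1 / (2 * s) with ht
  have ht0 : 0 < t := by positivity
  set hmax := Discretization.monConst Cstb Cred Crel γ * D.eta That ^ 2 + 1
  have hmax0 : 0 < hmax := by
    have : 0 < Discretization.monConst Cstb Cred Crel γ := Discretization.monConst_pos
    positivity
  have hσ1 : ρ ^ t < 1 := Real.rpow_lt_one hρ.le hρ' ht0
  have hσ2 : 0 < (1 - ρ ^ t)⁻¹ := inv_pos.2 (by linarith)
  -- `n` bounds the elements marked before `l₆`, the `+ 1` is that of `#T_l - #T_0 + 1`, and the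
  -- last summand is the geometric sum over the indices from `l₆` on.
  set C₃ := (Cmesh * n + 1) * hmax ^ t + Cmesh * (C₁ * (Clin ^ t * (1 - ρ ^ t)⁻¹)) with hC₃
  have hC₃0 : 0 < C₃ := by positivity
  refine ⟨C₃ ^ s, by positivity, fun C hC r hmesh l₆ hqo href hn => ⟨fun _ => ?_, fun _ => hfin⟩⟩
  intro l hl
  rw [r.est_of_solvable (hsol _ (href l hl))]
  have h0c : D.T0.card ≤ (r.mesh l).card :=
    Discretization.Admissible.card_le Relation.ReflTransGen.refl (r.admissible l)
  have h0c' : (D.T0.card : ℝ) ≤ (r.mesh l).card := by exact_mod_cast h0c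
  have hmc := hmesh l
  set c : ℝ := ((r.mesh l).card : ℝ) - D.T0.card + 1 with hc
  have hc0 : 0 < c := by linarith
  have hC0 : 0 < C := lt_of_lt_of_le (by positivity) hC
  rcases (D.eta_nonneg (r.mesh l)).eq_or_lt with hη | hη
  · rw [← hη]
    positivity
  set η := D.eta (r.mesh l)
  have hη2 : 0 < η ^ 2 := by positivity
  have hηmax : η ^ 2 ≤ hmax := by
    refine (Discretization.eta_sq_le_of_refines hA1 hA2 hA4 hqred' hCrel hγ hThat (href l hl)
      (hsol _ Relation.ReflTransGen.refl) (hsol _ (href l hl)) (hinf _ (href l hl))).trans ?_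
    exact le_add_of_nonneg_right zero_le_one
  have hone : 1 ≤ hmax ^ t * (η ^ 2) ^ (-t) := by
    rw [Real.rpow_neg hη2.le, ← div_eq_mul_inv, one_le_div (by positivity)]
    gcongr
  -- By linear convergence a vanishing earlier estimator would force `η = 0`, so the negative powers
  -- in the sum are meaningful.
  have hpos : ∀ j ∈ Finset.Ico l₆ l, 0 < D.eta (r.mesh j) := by
    intro j hj
    obtain ⟨hj, hjl⟩ := Finset.mem_Ico.1 hj
    have h2 := hlin r l₆ hqo href j hj (l - j)
    rw [Nat.add_sub_cancel' hjl.le] at h2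
    have h3 : 0 < D.eta (r.mesh j) ^ 2 :=
      pos_of_mul_pos_right (hη2.trans_le h2) (by positivity)
    exact (D.eta_nonneg _).lt_of_ne fun h => by simp [← h] at h3
  have hfirst : ∑ j ∈ Finset.range l₆, ((r.marked j).card : ℝ) ≤ n := by
    have h1 := r.sum_card_marked_le l₆
    have h2 : ∑ j ∈ Finset.range l₆, (r.marked j).card ≤ n := by omega
    exact_mod_cast h2
  have hsecond : ∑ j ∈ Finset.Ico l₆ l, ((r.marked j).card : ℝ) ≤
      C₁ * (Clin ^ t * (1 - ρ ^ t)⁻¹ * (η ^ 2) ^ (-t)) := by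
    calc _ ≤ ∑ j ∈ Finset.Ico l₆ l, C₁ * (D.eta (r.mesh j) ^ 2) ^ (-t) :=
          Finset.sum_le_sum fun j hj =>
            hmark r j (href j (Finset.mem_Ico.1 hj).1) (hpos j hj)
      _ = C₁ * ∑ j ∈ Finset.Ico l₆ l, (D.eta (r.mesh j) ^ 2) ^ (-t) := by rw [Finset.mul_sum]
      _ ≤ _ := mul_le_mul_of_nonneg_left (sum_rpow_neg_le
          (h := fun j => D.eta (r.mesh j) ^ 2) hClin hρ hρ' ht0 (hlin r l₆ hqo href) hη2) hC₁.le
  have hcC : c ≤ C₃ * (η ^ 2) ^ (-t) := by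
    rw [← Finset.sum_range_add_sum_Ico _ hl] at hmc
    have h1 : Cmesh * (∑ j ∈ Finset.range l₆, ((r.marked j).card : ℝ) +
        ∑ j ∈ Finset.Ico l₆ l, ((r.marked j).card : ℝ)) ≤
        Cmesh * (n + C₁ * (Clin ^ t * (1 - ρ ^ t)⁻¹ * (η ^ 2) ^ (-t))) := by gcongr
    have h2 : (Cmesh * n + 1) * 1 ≤ (Cmesh * n + 1) * (hmax ^ t * (η ^ 2) ^ (-t)) := by gcongr
    rw [hc, hC₃]
    linarith
  have hηpow : (((η ^ 2) ^ (-t)) ^ s) = η⁻¹ := by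
    rw [← Real.rpow_mul hη2.le, ← Real.rpow_natCast η 2, ← Real.rpow_mul hη.le, ← Real.rpow_neg_one,
      ht]
    congr 1
    field_simp
    norm_num
  have hcs : c ^ s ≤ C₃ ^ s * η⁻¹ := by
    calc c ^ s ≤ (C₃ * (η ^ 2) ^ (-t)) ^ s := by gcongr
      _ = _ := by rw [Real.mul_rpow hC₃0.le (by positivity), hηpow]
  rw [Real.rpow_neg hc0.le, ← div_eq_mul_inv, le_div_iff₀ (by positivity)]
  calc η * c ^ s ≤ η * (C₃ ^ s * η⁻¹) := by gcongr
    _ = C₃ ^ s := by field_simp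
    _ ≤ C := hC

end Rates

end AFEM

end

theorem theorem4p3 {𝕜 : Type*} [RCLike 𝕜] {H : Type*} [NormedAddCommGroup H]
    [InnerProductSpace 𝕜 H] [CompleteSpace H] [TopologicalSpace.SeparableSpace H]
    {d : ℕ} {Ω : Set (EuclideanSpace ℝ (Fin d))}
    (P : AFEM.Problem 𝕜 H) (D : AFEM.Discretization 𝕜 H Ω)
    (Cstb Cred qred Crel' Crel Cmesh Cmark : ℝ) (Cson : ℕ)
    (hCstb : 0 < Cstb) (hCred : 0 < Cred) (hqred : 0 < qred) (hqred' : qred < 1)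
    (hCrel' : 0 < Crel') (hCrel : 0 < Crel) (hCmesh : 1 ≤ Cmesh) (hCmark : 1 ≤ Cmark)
    (hA1 : D.Stability P Cstb) (hA2 : D.Reduction P Cred qred)
    (hA3 : D.Reliability P Crel') (hA4 : D.DiscreteReliability P Crel)
    (hsons : D.SonBounds Cson) (hoverlay : D.Overlay) :
    -- some uniform refinement has a uniform inf-sup bound for all larger discrete spaces
    (∃ (m : ℕ) (γ : ℝ), 0 < γ ∧ ∀ V : Submodule 𝕜 H, FiniteDimensional 𝕜 V →
      D.X (D.uniform m) ≤ V → ENNReal.ofReal γ ≤ P.infSup V) ∧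
    -- optimal rates, with the dependence of the indices and of the constant
    (∀ (m : ℕ) (γ : ℝ), 0 < γ →
      (∀ T, D.S.Refines (D.uniform m) T → ENNReal.ofReal γ ≤ P.infSup (D.X T)) →
      ∀ θ : ℝ, 0 < θ → θ < AFEM.thetaOpt Cstb Crel γ →
      ∃ ε : ℝ, 0 < ε ∧ ε < 1 ∧
        (∀ r : AFEM.AdaptiveRun P D θ Cmark, r.MeshClosure Cmesh → r.LimitDefinite →
          r.limitSpace = Set.univ → ∃ l₃ : ℕ, r.QuasiOrthogonalFrom ε l₃) ∧
        ∀ s : ℝ, 0 < s → ∀ n : ℕ, ∃ Copt : ℝ, 0 < Copt ∧ ∀ C ≥ Copt,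
          ∀ r : AFEM.AdaptiveRun P D θ Cmark, r.MeshClosure Cmesh → r.LimitDefinite →
          r.limitSpace = Set.univ →
          ∀ l₃ l₅ : ℕ, r.QuasiOrthogonalFrom ε l₃ →
          (∀ l ≥ l₅, D.S.Refines (D.uniform m) (r.mesh l)) →
          (r.mesh (max l₃ l₅)).card = n →
          (D.approxNorm P s < ⊤ ↔ r.RateFrom s C (max l₃ l₅))) ∧
    -- optimal rates without reference to the indices
    (∀ (m : ℕ) (γ : ℝ), 0 < γ →
      (∀ V : Submodule 𝕜 H, FiniteDimensional 𝕜 V → D.X (D.uniform m) ≤ V →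
        ENNReal.ofReal γ ≤ P.infSup V) →
      ∀ θ : ℝ, 0 < θ → θ < AFEM.thetaOpt Cstb Crel γ →
      ∀ r : AFEM.AdaptiveRun P D θ Cmark, r.MeshClosure Cmesh → r.LimitDefinite →
      r.limitSpace = Set.univ →
      ∃ l₆ : ℕ, ∀ s : ℝ, 0 < s → ∃ Copt : ℝ, 0 < Copt ∧ ∀ C ≥ Copt,
        (D.approxNorm P s < ⊤ ↔ r.RateFrom s C l₆)) := by
  have mono : ∀ {θ ε : ℝ} (r : AFEM.AdaptiveRun P D θ Cmark) {k l : ℕ}, k ≤ l →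
      r.QuasiOrthogonalFrom ε k → r.QuasiOrthogonalFrom ε l := fun r _ _ hkl h j hj =>
    h j (hkl.trans hj)
  refine ⟨?_, ?_, ?_⟩
  · obtain ⟨m, γ, hγ, h⟩ := P.exists_le_infSup (AFEM.Discretization.monotone_X_uniform (D := D))
      AFEM.Discretization.dense_uniform
    exact ⟨m, γ, hγ, fun V _ hV => h V hV⟩
  · intro m γ hγ hinf θ hθ hθ'
    obtain ⟨ε, hε, hε', h⟩ := AFEM.exists_optimal_rates hCstb hqred hqred' hCrel hCmesh hCmark
      hA1 hA2 hA3 hA4 hsons hoverlay hγ (AFEM.Discretization.admissible_uniform m) hinf hθ hθ'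
    refine ⟨ε, hε, hε', fun r _ _ hr => r.exists_quasiOrthogonalFrom hr hε hε', fun s hs n => ?_⟩
    obtain ⟨Copt, hCopt, h⟩ := h s hs n
    exact ⟨Copt, hCopt, fun C hC r hmesh _ _ l₃ l₅ hqo href hn =>
      h C hC r hmesh _ (mono r (le_max_left _ _) hqo)
        (fun l hl => href l ((le_max_right _ _).trans hl)) hn⟩
  · intro m γ hγ hF θ hθ hθ' r hmesh _ hr
    obtain ⟨γ', hγ', hlt, hθγ'⟩ := AFEM.exists_thetaOpt_lt hγ hθ'
    have := D.finiteDimensional _ (AFEM.Discretization.admissible_uniform m)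
    -- The mesh `r.mesh N` of the run takes the role of the uniform mesh, with the slightly smaller
    -- `γ'`.
    obtain ⟨N, hN⟩ := P.exists_infSup_transfer hγ' hlt hF r.monotone_X hr
    obtain ⟨ε, hε, hε', h⟩ := AFEM.exists_optimal_rates hCstb hqred hqred' hCrel hCmesh hCmark
      hA1 hA2 hA3 hA4 hsons hoverlay hγ' (r.admissible N)
      (fun T hT => hN _ (D.nested _ _ (r.admissible N) hT)) hθ hθγ'
    obtain ⟨l₃, hl₃⟩ := r.exists_quasiOrthogonalFrom hr hε hε'
    refine ⟨max l₃ N, fun s hs => ?_⟩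
    obtain ⟨Copt, hCopt, h⟩ := h s hs (r.mesh (max l₃ N)).card
    exact ⟨Copt, hCopt, fun C hC => h C hC r hmesh _ (mono r (le_max_left _ _) hl₃)
      (fun l hl => r.refines_of_le ((le_max_right _ _).trans hl)) rfl⟩
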